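/- **Setting.** Let $0\le\gamma<1$, $\delta>0$, $d>0$, $\mu>3/2$ (real), $T>0$, and put $\kappa_1=\frac1{\delta+\gamma}$, $\kappa_2=1-\gamma$, $\lambda=\frac{\delta^2-\gamma}{(\delta+\gamma)^2}$. Let $(\cdot,\cdot)$ and $\|\cdot\|$ be the inner product and norm of $L^2(0,1)$, let $\widehat g(k)=\int_0^1 g(x)e^{-2\pi i kx}\,dx$, and let $H^s$ be the Sobolev space of $1$-periodic functions with norm $\|g\|_s=\big(\sum_{k\in\mathbb Z}(1+k^2)^s|\widehat g(k)|^2\big)^{1/2}$. Suppose that the real functions $\zeta,u\in C^1([0,T];H^\mu)$ solve the periodic initial-value problem for the classical Boussinesq system (the $(a,b,c,d)$-system with $a=b=c=0$, $d>0$) $$\zeta_t+\kappa_1u_x+\lambda(\zeta u)_x=0,\qquad u_t+\kappa_2\zeta_x+\lambda uu_x-d\,u_{xxt}=0,\qquad \zeta(0)=\zeta_0,\ u(0)=u_0,$$ for $0\le t\le T$, in the sense of periodic distributions in $x$. For an integer $N\ge1$ let $S_N=\mathrm{span}\{e^{2\pi ikx}:-N\le k\le N\}$, let $P$ be the $L^2$-projection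 onto $S_N$, and consider the spectral Galerkin approximation: real-valued $\zeta_N,u_N:[0,T]\to S_N$, differentiable in $t$, such that for $0\le t\le T$ and all $\varphi,\chi\in S_N$ $$(\zeta_{Nt},\varphi)+\kappa_1(u_{Nx},\varphi)+\lambda((\zeta_Nu_N)_x,\varphi)=0,$$ $$(u_{Nt},\chi)+\kappa_2(\zeta_{Nx},\chi)+\lambda(u_Nu_{Nx},\chi)-d(u_{Nxxt},\chi)=0,$$ and $\zeta_N(0)=P\zeta_0$, $u_N(0)=Pu_0$. **Proposition.** For all sufficiently large $N$ the Galerkin problem has a solution on $[0,T]$; for every $N\ge1$ it has at most one. There is a constant $C$, independent of $N$, such that for every $N\ge 1$ for which the solution $(\zeta_N,u_N)$ exists on $[0,T]$ $$\max_{0\le t\le T}\big(\|\zeta_N-\zeta\|+\|u_N-u\|_1\big)\le C\,N^{1-\mu}.$$ -/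

import Mathlib

open Set Filter Topology MeasureTheory

namespace Boussinesq

noncomputable section

/-! ### Periodic functions and Sobolev spaces on `[0,1]` -/

/-- The `k`-th Fourier coefficient `∫₀¹ g(x) e^{-2πikx} dx` of a real `1`-periodic function. -/
def coeff (g : ℝ → ℝ) (k : ℤ) : ℂ :=
  fourierCoeffOn (zero_lt_one (α := ℝ)) (fun x => (g x : ℂ)) k

/-- The exponential `x ↦ e^{2πikx}`. -/
def expo (k : ℤ) (x : ℝ) : ℂ :=
  Complex.exp (2 * (Real.pi : ℂ) * Complex.I * (k : ℂ) * (x : ℂ))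

/-- The norm of `L²(0,1)`. -/
def normL2 (g : ℝ → ℝ) : ℝ :=
  Real.sqrt (∫ x in (0 : ℝ)..1, g x ^ 2)

/-- `g` is (a representative of) an element of the periodic Sobolev space `H^μ` on `[0,1]`. -/
structure MemH (μ : ℝ) (g : ℝ → ℝ) : Prop where
  periodic : Function.Periodic g 1
  memLp : MemLp g 2 (volume.restrict (Ioc (0 : ℝ) 1))
  summable : Summable fun k : ℤ => (1 + (k : ℝ) ^ 2) ^ μ * ‖coeff g k‖ ^ 2

/-- The norm of `H^μ`, `‖g‖_μ = (∑_k (1 + k²)^μ |ĝ(k)|²)^{1/2}`. -/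
def normH (μ : ℝ) (g : ℝ → ℝ) : ℝ :=
  Real.sqrt (∑' k : ℤ, (1 + (k : ℝ) ^ 2) ^ μ * ‖coeff g k‖ ^ 2)

/-- `f ∈ C¹([0,T]; H^μ)` with time derivative `f'`: the difference quotients of `f` converge to
`f'` in the norm of `H^μ` (one-sidedly at the end points), and `f'` is continuous into `H^μ`.
The first argument of `f` and `f'` is time, the second one is space. -/
structure IsC1Curve (μ T : ℝ) (f f' : ℝ → ℝ → ℝ) : Prop where
  mem : ∀ t ∈ Icc (0 : ℝ) T, MemH μ (f t)
  mem_deriv : ∀ t ∈ Icc (0 : ℝ) T, MemH μ (f' t)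
  hasDeriv : ∀ t ∈ Icc (0 : ℝ) T,
    Tendsto (fun s => normH μ (fun x => (s - t)⁻¹ * (f s x - f t x) - f' t x))
      (𝓝[Icc (0 : ℝ) T \ {t}] t) (𝓝 0)
  continuous_deriv : ∀ t ∈ Icc (0 : ℝ) T,
    Tendsto (fun s => normH μ (fun x => f' s x - f' t x)) (𝓝[Icc (0 : ℝ) T] t) (𝓝 0)

/-! ### The coefficients of the system -/

/-- `κ₁ = 1/(δ+γ)`. -/
def kappa1 (γ δ : ℝ) : ℝ := 1 / (δ + γ)

/-- `κ₂ = 1-γ`. -/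
def kappa2 (γ : ℝ) : ℝ := 1 - γ

/-- `λ = (δ²-γ)/(δ+γ)²`. -/
def lam (γ δ : ℝ) : ℝ := (δ ^ 2 - γ) / (δ + γ) ^ 2

/-! ### The periodic initial-value problem -/

/-- `ζ, u ∈ C¹([0,T]; H^μ)` solve, for every time in `[0,T]` and in the sense of periodic
distributions in space,
`ζ_t + κ₁ u_x + λ (ζu)_x + a u_xxx - b ζ_xxt = 0`,
`u_t + κ₂ ζ_x + λ u u_x + (1-γ) c ζ_xxx - d u_xxt = 0`,
with `ζ(0) = ζ₀`, `u(0) = u₀`. The equations are tested with smooth `1`-periodic functions, all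
space derivatives being moved to the test function, with `u u_x = (u²/2)_x`. -/
def IsSolution (γ δ a b c d μ T : ℝ) (ζ₀ u₀ : ℝ → ℝ) (ζ u : ℝ → ℝ → ℝ) : Prop :=
  ∃ ζt ut : ℝ → ℝ → ℝ,
    IsC1Curve μ T ζ ζt ∧ IsC1Curve μ T u ut ∧
    (∀ t ∈ Icc (0 : ℝ) T, ∀ φ : ℝ → ℝ,
      ContDiff ℝ (⊤ : ℕ∞) φ → Function.Periodic φ 1 →
      (∫ x in (0 : ℝ)..1, ζt t x * φ x)
        - kappa1 γ δ * (∫ x in (0 : ℝ)..1, u t x * deriv φ x)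
        - lam γ δ * (∫ x in (0 : ℝ)..1, ζ t x * u t x * deriv φ x)
        - a * (∫ x in (0 : ℝ)..1, u t x * iteratedDeriv 3 φ x)
        - b * (∫ x in (0 : ℝ)..1, ζt t x * iteratedDeriv 2 φ x) = 0) ∧
    (∀ t ∈ Icc (0 : ℝ) T, ∀ φ : ℝ → ℝ,
      ContDiff ℝ (⊤ : ℕ∞) φ → Function.Periodic φ 1 →
      (∫ x in (0 : ℝ)..1, ut t x * φ x)
        - kappa2 γ * (∫ x in (0 : ℝ)..1, ζ t x * deriv φ x)
        - lam γ δ * (∫ x in (0 : ℝ)..1, u t x ^ 2 / 2 * deriv φ x)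
        - (1 - γ) * c * (∫ x in (0 : ℝ)..1, ζ t x * iteratedDeriv 3 φ x)
        - d * (∫ x in (0 : ℝ)..1, ut t x * iteratedDeriv 2 φ x) = 0) ∧
    ζ 0 =ᵐ[volume] ζ₀ ∧ u 0 =ᵐ[volume] u₀

/-! ### The spectral Galerkin semidiscretization -/

/-- `S_N = span {e^{2πikx} : -N ≤ k ≤ N}`. -/
def trigSpace (N : ℕ) : Submodule ℂ (ℝ → ℂ) :=
  Submodule.span ℂ (expo '' Icc (-(N : ℤ)) (N : ℤ))

/-- The `L²`-projection `P g = ∑_{|k| ≤ N} ĝ(k) e^{2πikx}` onto `S_N`. -/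
def proj (N : ℕ) (g : ℝ → ℝ) (x : ℝ) : ℂ :=
  ∑ k ∈ Finset.Icc (-(N : ℤ)) (N : ℤ), coeff g k * expo k x

/-- The real function `g` belongs to `S_N`. -/
def MemTrig (N : ℕ) (g : ℝ → ℝ) : Prop :=
  (fun x => (g x : ℂ)) ∈ trigSpace N

/-- The inner product `(g, φ) = ∫₀¹ g φ̄` of `L²(0,1)`. -/
def ip (g : ℝ → ℝ) (φ : ℝ → ℂ) : ℂ :=
  ∫ x in (0 : ℝ)..1, (g x : ℂ) * (starRingEnd ℂ) (φ x)

/-- The real-valued `ζN, uN : [0,T] → S_N` solve the semidiscrete problem with initial values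
`P ζ₀, P u₀`. The functions `ζNt, uNt` are the time derivatives of `ζN, uN`. -/
def IsGalerkin (γ δ a b c d T : ℝ) (N : ℕ) (ζ₀ u₀ : ℝ → ℝ) (ζN uN : ℝ → ℝ → ℝ) : Prop :=
  (∀ t ∈ Icc (0 : ℝ) T, MemTrig N (ζN t) ∧ MemTrig N (uN t)) ∧
  (∃ ζNt uNt : ℝ → ℝ → ℝ,
    (∀ t ∈ Icc (0 : ℝ) T, ∀ x : ℝ,
      HasDerivWithinAt (fun s => ζN s x) (ζNt t x) (Icc (0 : ℝ) T) t ∧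
      HasDerivWithinAt (fun s => uN s x) (uNt t x) (Icc (0 : ℝ) T) t) ∧
    (∀ t ∈ Icc (0 : ℝ) T, ∀ φ ∈ trigSpace N,
      ip (ζNt t) φ + (kappa1 γ δ : ℂ) * ip (deriv (uN t)) φ
        + (lam γ δ : ℂ) * ip (deriv (fun x => ζN t x * uN t x)) φ
        + (a : ℂ) * ip (iteratedDeriv 3 (uN t)) φ
        - (b : ℂ) * ip (iteratedDeriv 2 (ζNt t)) φ = 0) ∧
    (∀ t ∈ Icc (0 : ℝ) T, ∀ χ ∈ trigSpace N,
      ip (uNt t) χ + (kappa2 γ : ℂ) * ip (deriv (ζN t)) χ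
        + (lam γ δ : ℂ) * ip (fun x => uN t x * deriv (uN t) x) χ
        + ((1 - γ) * c : ℂ) * ip (iteratedDeriv 3 (ζN t)) χ
        - (d : ℂ) * ip (iteratedDeriv 2 (uNt t)) χ = 0)) ∧
  (∀ x : ℝ, (ζN 0 x : ℂ) = proj N ζ₀ x ∧ (uN 0 x : ℂ) = proj N u₀ x)

end

end Boussinesq

namespace Boussinesq

noncomputable section

/-! ### Weighted summable sequences and convolutions -/

/-! In Fourier coefficients the exact solution satisfies, at every frequency, the equations with
right-hand sides `rhsZ` and `rhsU`; the Galerkin approximation satisfies them on `box N` only. Let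
θ, ξ be the Galerkin approximation minus the truncated exact solution, and E = ‖θ‖² + ‖ξ‖² +
d‖ξ_x‖². Since E(0) = 0, the estimate E' ≤ 2K(E + τ√E), with τ of order N^{1-μ} bounding the H¹ size
of the truncation error, yields E ≲ τ² by Grönwall. The truncation error itself is added at the end.

The energy controls ξ in H¹ but θ only in L². Hence every term must be arranged so that no
derivative falls on θ. This is immediate for all terms except (u_N θ)_x tested with θ; there
antisymmetry (`abs_re_skew_le`) moves the derivative to u_N. The price is a bound on u_N and its
derivative in a norm stronger than the sup norm, here `wnorm`. The exact part of u_N has it by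
Sobolev embedding, which is where μ > 3/2 enters (`SobSummable.wSummable`); ξ has it by the inverse
inequality `wnorm_le_sqrt_hsq` as long as N·E stays bounded. `conv_truncation` splits the
nonlinearity accordingly and `energyRate_le` collects the terms.

Boundedness of N·E and existence up to time T come together from a cut-off. In the modified system
the error is multiplied by a factor that is 1 where N·E ≤ 1 and 0 where N·E ≥ 2. That system is
solvable on all of [0,T] (`exists_solution_of_cutoff`), and the energy estimate holds for it with
constants independent of N. It gives N·E ≤ C N^{3-2μ}, which tends to 0, so for large N the factor
is identically 1 and the Galerkin system itself has been solved. Uniqueness carries the bound to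
every Galerkin solution with large N. For each of the finitely many other N the error is bounded on
[0,T], and the constant absorbs these bounds. -/

/-- The frequencies `-N, …, N`. -/
def box (N : ℕ) : Finset ℤ := Finset.Icc (-(N : ℤ)) (N : ℤ)

/-- The sequences `a` with `∑ (1 + |k|) |a k| < ∞`. -/
def WSummable (a : ℤ → ℂ) : Prop := Summable fun k : ℤ => (1 + |(k : ℝ)|) * ‖a k‖

/-- The weighted `ℓ¹` norm. -/
def wnorm (a : ℤ → ℂ) : ℝ := ∑' k : ℤ, (1 + |(k : ℝ)|) * ‖a k‖

/-- The weighted `ℓ²` norm, squared. -/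
def hsq (a : ℤ → ℂ) : ℝ := ∑' k : ℤ, ((1 + |(k : ℝ)|) * ‖a k‖) ^ 2

/-- The convolution of two sequences. -/
def conv (a b : ℤ → ℂ) (k : ℤ) : ℂ := ∑' m : ℤ, a (k - m) * b m

/-- The sequences of Fourier coefficients of real functions. -/
def Hermitian (a : ℤ → ℂ) : Prop := ∀ k, a (-k) = (starRingEnd ℂ) (a k)

/-- The truncation of a sequence to the frequencies in `box N`. -/
def trunc (N : ℕ) (a : ℤ → ℂ) (k : ℤ) : ℂ := if k ∈ box N then a k else 0

lemma mem_box {N : ℕ} {k : ℤ} : k ∈ box N ↔ -(N : ℤ) ≤ k ∧ k ≤ N := Finset.mem_Icc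

lemma neg_mem_box {N : ℕ} {k : ℤ} : -k ∈ box N ↔ k ∈ box N := by
  simp only [mem_box]; omega

lemma card_box (N : ℕ) : (box N).card = 2 * N + 1 := by
  rw [box, Int.card_Icc]; omega

lemma trunc_of_mem {N : ℕ} {a : ℤ → ℂ} {k : ℤ} (h : k ∈ box N) : trunc N a k = a k := if_pos h

lemma trunc_of_notMem {N : ℕ} {a : ℤ → ℂ} {k : ℤ} (h : k ∉ box N) : trunc N a k = 0 := if_neg h

lemma Hermitian.trunc {a : ℤ → ℂ} (h : Hermitian a) (N : ℕ) : Hermitian (trunc N a) := by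
  intro k
  by_cases hk : k ∈ box N
  · rw [trunc_of_mem hk, trunc_of_mem (neg_mem_box.2 hk), h k]
  · rw [trunc_of_notMem hk, trunc_of_notMem (fun h => hk (neg_mem_box.1 h)), map_zero]

lemma Hermitian.add {a b : ℤ → ℂ} (ha : Hermitian a) (hb : Hermitian b) : Hermitian (a + b) := by
  intro k; simp [ha k, hb k]

lemma Hermitian.real_smul {a : ℤ → ℂ} (ha : Hermitian a) (s : ℝ) :
    Hermitian ((s : ℂ) • a) := by
  intro k; simp [ha k]

lemma WSummable.norm {a : ℤ → ℂ} (h : WSummable a) : Summable fun k => ‖a k‖ :=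
  Summable.of_nonneg_of_le (fun _ => norm_nonneg _)
    (fun k => le_mul_of_one_le_left (norm_nonneg _) (by linarith [abs_nonneg (k : ℝ)])) h

lemma WSummable.mono {a b : ℤ → ℂ} (h : WSummable a) (hb : ∀ k, ‖b k‖ ≤ ‖a k‖) : WSummable b :=
  Summable.of_nonneg_of_le (fun _ => by positivity)
    (fun k => mul_le_mul_of_nonneg_left (hb k) (by positivity)) h

lemma wnorm_mono {a b : ℤ → ℂ} (h : WSummable a) (hb : ∀ k, ‖b k‖ ≤ ‖a k‖) :
    wnorm b ≤ wnorm a :=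
  (h.mono hb).tsum_le_tsum (fun k => mul_le_mul_of_nonneg_left (hb k) (by positivity)) h

lemma WSummable.add {a b : ℤ → ℂ} (ha : WSummable a) (hb : WSummable b) : WSummable (a + b) :=
  Summable.of_nonneg_of_le (fun _ => by positivity)
    (fun k => by
      rw [← mul_add]
      exact mul_le_mul_of_nonneg_left (norm_add_le (a k) (b k)) (by positivity))
    (Summable.add ha hb)

lemma wnorm_add_le {a b : ℤ → ℂ} (ha : WSummable a) (hb : WSummable b) :
    wnorm (a + b) ≤ wnorm a + wnorm b := by
  rw [wnorm, wnorm, wnorm, ← Summable.tsum_add ha hb]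
  refine (ha.add hb).tsum_le_tsum (fun k => ?_) (Summable.add ha hb)
  rw [← mul_add]
  exact mul_le_mul_of_nonneg_left (norm_add_le (a k) (b k)) (by positivity)

lemma WSummable.smul {a : ℤ → ℂ} (ha : WSummable a) (c : ℂ) : WSummable (c • a) := by
  refine (Summable.mul_left ‖c‖ ha).congr fun k => ?_
  simp only [Pi.smul_apply, norm_smul]; ring

lemma wnorm_smul (c : ℂ) (a : ℤ → ℂ) : wnorm (c • a) = ‖c‖ * wnorm a := by
  rw [wnorm, wnorm, ← tsum_mul_left]
  refine tsum_congr fun k => ?_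
  simp only [Pi.smul_apply, norm_smul]; ring

lemma WSummable.sub {a b : ℤ → ℂ} (ha : WSummable a) (hb : WSummable b) : WSummable (a - b) := by
  have := ha.add (hb.smul (-1))
  simpa [sub_eq_add_neg] using this

lemma WSummable.sq {a : ℤ → ℂ} (h : WSummable a) :
    Summable fun k : ℤ => ((1 + |(k : ℝ)|) * ‖a k‖) ^ 2 :=
  Summable.of_nonneg_of_le (fun _ => sq_nonneg _)
    (fun k => by
      rw [pow_two]
      exact mul_le_mul_of_nonneg_right (h.le_tsum k fun _ _ => by positivity) (by positivity))
    (Summable.mul_left (wnorm a) h)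

lemma wnorm_nonneg (a : ℤ → ℂ) : 0 ≤ wnorm a := tsum_nonneg fun _ => by positivity

lemma wSummable_of_support {N : ℕ} {a : ℤ → ℂ} (h : ∀ k ∉ box N, a k = 0) : WSummable a :=
  summable_of_ne_finset_zero (s := box N) fun k hk => by simp [h k hk]

lemma wSummable_trunc (a : ℤ → ℂ) (N : ℕ) : WSummable (trunc N a) :=
  wSummable_of_support (N := N) fun _ hk => trunc_of_notMem hk

lemma wnorm_trunc_le {a : ℤ → ℂ} (h : WSummable a) (N : ℕ) : wnorm (trunc N a) ≤ wnorm a :=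
  wnorm_mono h fun k => by
    by_cases hk : k ∈ box N
    · rw [trunc_of_mem hk]
    · rw [trunc_of_notMem hk]; simp

lemma WSummable.summable_conv {a b : ℤ → ℂ} (ha : WSummable a) (hb : WSummable b) (k : ℤ) :
    Summable fun m => a (k - m) * b m := by
  refine Summable.of_norm_bounded (Summable.mul_left (∑' j, ‖a j‖) hb.norm) fun m => ?_
  rw [norm_mul]
  exact mul_le_mul_of_nonneg_right (ha.norm.le_tsum _ fun _ _ => norm_nonneg _) (norm_nonneg _)

lemma conv_comm (a b : ℤ → ℂ) : conv a b = conv b a := by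
  ext k
  rw [conv, conv, ← (Equiv.subLeft k).tsum_eq]
  exact tsum_congr fun m => by simp [mul_comm]

lemma conv_add {a b c : ℤ → ℂ} (ha : WSummable a) (hb : WSummable b) (hc : WSummable c) :
    conv a (b + c) = conv a b + conv a c := by
  ext k
  simp only [conv, Pi.add_apply, mul_add]
  exact (ha.summable_conv hb k).tsum_add (ha.summable_conv hc k)

lemma add_conv {a b c : ℤ → ℂ} (ha : WSummable a) (hb : WSummable b) (hc : WSummable c) :
    conv (a + b) c = conv a c + conv b c := by
  rw [conv_comm, conv_add hc ha hb, conv_comm c a, conv_comm c b]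

lemma conv_smul (s : ℂ) (a b : ℤ → ℂ) : conv a (s • b) = s • conv a b := by
  ext k
  simp only [conv, Pi.smul_apply, smul_eq_mul, ← tsum_mul_left]
  exact tsum_congr fun m => by ring

lemma conv_eq_sum {N : ℕ} {b : ℤ → ℂ} (hb : ∀ k ∉ box N, b k = 0) (a : ℤ → ℂ) (k : ℤ) :
    conv a b k = ∑ m ∈ box N, a (k - m) * b m :=
  tsum_eq_sum fun m hm => by rw [hb m hm, mul_zero]

/-! ### Trilinear estimates and antisymmetry -/

/-- Young's inequality in trilinear form. -/
lemma sum_sum_mul_le (I J : Finset ℤ) {x y c : ℤ → ℝ} (hc0 : ∀ k, 0 ≤ c k) (hc : Summable c) :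
    ∑ k ∈ I, ∑ m ∈ J, x k * c (k - m) * y m
      ≤ (∑' j, c j) * √(∑ k ∈ I, x k ^ 2) * √(∑ m ∈ J, y m ^ 2) := by
  have hS : ∀ (I : Finset ℤ) (f : ℤ → ℤ), Function.Injective f →
      ∑ k ∈ I, c (f k) ≤ ∑' j, c j := fun I f hf =>
    ((hc.comp_injective hf).sum_le_tsum I fun _ _ => hc0 _).trans
      (tsum_comp_le_tsum_of_inj hc hc0 hf)
  have hC : 0 ≤ ∑' j, c j := tsum_nonneg hc0
  -- Schur test: the kernel is split as √c·√c, and Cauchy–Schwarz over pairs leaves row and column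
  -- sums of c, each at most its full sum.
  have h1 : ∑ p ∈ I ×ˢ J, (x p.1 * √(c (p.1 - p.2))) ^ 2 ≤ (∑' j, c j) * ∑ k ∈ I, x k ^ 2 := by
    rw [Finset.sum_product, Finset.mul_sum]
    refine Finset.sum_le_sum fun k _ => ?_
    simp only [mul_pow, Real.sq_sqrt (hc0 _)]
    rw [← Finset.mul_sum, mul_comm]
    exact mul_le_mul_of_nonneg_right (hS J (fun m => k - m) sub_right_injective) (sq_nonneg _)
  have h2 : ∑ p ∈ I ×ˢ J, (√(c (p.1 - p.2)) * y p.2) ^ 2 ≤ (∑' j, c j) * ∑ m ∈ J, y m ^ 2 := by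
    rw [Finset.sum_product_right, Finset.mul_sum]
    refine Finset.sum_le_sum fun m _ => ?_
    simp only [mul_pow, Real.sq_sqrt (hc0 _)]
    rw [← Finset.sum_mul]
    exact mul_le_mul_of_nonneg_right (hS I (fun k => k - m) sub_left_injective) (sq_nonneg _)
  calc ∑ k ∈ I, ∑ m ∈ J, x k * c (k - m) * y m
      = ∑ p ∈ I ×ˢ J, (x p.1 * √(c (p.1 - p.2))) * (√(c (p.1 - p.2)) * y p.2) := by
        rw [Finset.sum_product]
        refine Finset.sum_congr rfl fun k _ => Finset.sum_congr rfl fun m _ => ?_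
        linear_combination (-x k * y m) * Real.mul_self_sqrt (hc0 (k - m))
    _ ≤ √((∑' j, c j) * ∑ k ∈ I, x k ^ 2) * √((∑' j, c j) * ∑ m ∈ J, y m ^ 2) :=
        (Real.sum_mul_le_sqrt_mul_sqrt _ _ _).trans
          (mul_le_mul (Real.sqrt_le_sqrt h1) (Real.sqrt_le_sqrt h2) (Real.sqrt_nonneg _)
            (Real.sqrt_nonneg _))
    _ = _ := by
        rw [Real.sqrt_mul hC, Real.sqrt_mul hC]
        linear_combination (√(∑ k ∈ I, x k ^ 2) * √(∑ m ∈ J, y m ^ 2)) * Real.mul_self_sqrt hC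

/-- The bound `|(x, (c y)_x)| ≤ ‖c‖ ‖x‖ ‖y‖₁` for trigonometric series. -/
lemma sum_mul_conv_le (I : Finset ℤ) (x : ℤ → ℂ) {c y : ℤ → ℂ} (hc : WSummable c)
    (hy : WSummable y) :
    ∑ k ∈ I, ‖x k‖ * (|(k : ℝ)| * ‖conv c y k‖)
      ≤ wnorm c * √(∑ k ∈ I, ‖x k‖ ^ 2) * √(hsq y) := by
  set γ : ℤ → ℝ := fun j => (1 + |(j : ℝ)|) * ‖c j‖ with hγ
  set v : ℤ → ℝ := fun j => (1 + |(j : ℝ)|) * ‖y j‖ with hv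
  have hγ0 : ∀ j, 0 ≤ γ j := fun j => by positivity
  have hv0 : ∀ j, 0 ≤ v j := fun j => by positivity
  have hs : ∀ k : ℤ, Summable fun m => γ (k - m) * v m := fun k =>
    Summable.of_nonneg_of_le (fun m => mul_nonneg (hγ0 _) (hv0 _))
      (fun m => mul_le_mul_of_nonneg_right (Summable.le_tsum hc (k - m) fun j _ => hγ0 j) (hv0 _))
      (Summable.mul_left (wnorm c) hy)
  have h1 : ∀ k : ℤ, |(k : ℝ)| * ‖conv c y k‖ ≤ ∑' m, γ (k - m) * v m := by
    intro k
    have hn : Summable fun m => ‖c (k - m) * y m‖ := (hc.summable_conv hy k).norm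
    calc |(k : ℝ)| * ‖conv c y k‖ ≤ |(k : ℝ)| * ∑' m, ‖c (k - m) * y m‖ :=
          mul_le_mul_of_nonneg_left (norm_tsum_le_tsum_norm hn) (abs_nonneg _)
      _ = ∑' m, |(k : ℝ)| * ‖c (k - m) * y m‖ := tsum_mul_left.symm
      _ ≤ _ := by
        refine (hn.mul_left _).tsum_le_tsum (fun m => ?_) (hs k)
        -- The derivative of the product is distributed over both factors, so each carries its own
        -- weight.
        have : |(k : ℝ)| ≤ (1 + |((k - m : ℤ) : ℝ)|) * (1 + |(m : ℝ)|) := by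
          have h := abs_add_le ((k : ℝ) - m) m
          rw [sub_add_cancel] at h
          push_cast
          nlinarith [abs_nonneg ((k : ℝ) - m), abs_nonneg (m : ℝ)]
        calc |(k : ℝ)| * ‖c (k - m) * y m‖
            ≤ (1 + |((k - m : ℤ) : ℝ)|) * (1 + |(m : ℝ)|) * ‖c (k - m) * y m‖ :=
              mul_le_mul_of_nonneg_right this (norm_nonneg _)
          _ = _ := by rw [norm_mul, hγ, hv]; ring
  calc ∑ k ∈ I, ‖x k‖ * (|(k : ℝ)| * ‖conv c y k‖)
      ≤ ∑ k ∈ I, ∑' m, ‖x k‖ * γ (k - m) * v m := by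
        refine Finset.sum_le_sum fun k _ => ?_
        simp only [mul_assoc]
        rw [tsum_mul_left]
        exact mul_le_mul_of_nonneg_left (h1 k) (norm_nonneg _)
    _ = ∑' m, ∑ k ∈ I, ‖x k‖ * γ (k - m) * v m := by
        refine (Summable.tsum_finsetSum fun k _ => ?_).symm
        simpa only [mul_assoc] using (hs k).mul_left ‖x k‖
    _ ≤ _ := by
        refine Real.tsum_le_of_sum_le (fun m => Finset.sum_nonneg fun k _ =>
          mul_nonneg (mul_nonneg (norm_nonneg _) (hγ0 _)) (hv0 _)) fun J => ?_
        rw [Finset.sum_comm]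
        refine (sum_sum_mul_le I J hγ0 hc).trans ?_
        refine mul_le_mul_of_nonneg_left (Real.sqrt_le_sqrt ?_)
          (mul_nonneg (wnorm_nonneg c) (Real.sqrt_nonneg _))
        exact hy.sq.sum_le_tsum J fun _ _ => sq_nonneg _

/-- Antisymmetry: `((V θ)_x, θ) = ½ (V_x θ, θ)`. -/
lemma abs_re_skew_le {N : ℕ} {V θ : ℤ → ℂ} (hV : WSummable V) (hVH : Hermitian V)
    (hθ : ∀ k ∉ box N, θ k = 0) :
    |∑ k ∈ box N, ((starRingEnd ℂ) (θ k) * (Complex.I * k * conv V θ k)).re|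
      ≤ wnorm V * ∑ k ∈ box N, ‖θ k‖ ^ 2 := by
  set S : ℂ := ∑ k ∈ box N, ∑ m ∈ box N,
    (starRingEnd ℂ) (θ k) * (Complex.I * k * (V (k - m) * θ m)) with hS
  have h1 : ∑ k ∈ box N, ((starRingEnd ℂ) (θ k) * (Complex.I * k * conv V θ k)).re = S.re := by
    rw [hS, Complex.re_sum]
    refine Finset.sum_congr rfl fun k _ => ?_
    rw [conv_eq_sum hθ, Finset.mul_sum, Finset.mul_sum]
  -- Conjugation followed by exchanging k and m restores the kernel, because V is Hermitian, but
  -- turns the symbol ik into -im. In S + S̄ the symbol is therefore i(k - m), a derivative of V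
  -- alone.
  have h2 : (starRingEnd ℂ) S = ∑ k ∈ box N, ∑ m ∈ box N,
      (starRingEnd ℂ) (θ k) * (-Complex.I * m * (V (k - m) * θ m)) := by
    simp only [hS, map_sum]
    rw [Finset.sum_comm]
    refine Finset.sum_congr rfl fun k _ => Finset.sum_congr rfl fun m _ => ?_
    have := hVH (m - k)
    rw [neg_sub] at this
    simp only [map_mul, Complex.conj_conj, Complex.conj_I, this, map_intCast]
    ring
  have h3 : ((2 * S.re : ℝ) : ℂ) = ∑ k ∈ box N, ∑ m ∈ box N,
      (starRingEnd ℂ) (θ k) * (Complex.I * ((k - m : ℤ) : ℂ) * (V (k - m) * θ m)) := by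
    rw [← Complex.add_conj, h2, hS, ← Finset.sum_add_distrib]
    refine Finset.sum_congr rfl fun k _ => ?_
    rw [← Finset.sum_add_distrib]
    refine Finset.sum_congr rfl fun m _ => ?_
    push_cast; ring
  have h4 : 2 * |S.re| ≤ wnorm V * ∑ k ∈ box N, ‖θ k‖ ^ 2 := by
    have h5 : 2 * |S.re| = ‖((2 * S.re : ℝ) : ℂ)‖ := by
      rw [Complex.norm_real, Real.norm_eq_abs, abs_mul, abs_two]
    rw [h5, h3]
    calc _ ≤ ∑ k ∈ box N, ∑ m ∈ box N,
          ‖θ k‖ * ((1 + |((k - m : ℤ) : ℝ)|) * ‖V (k - m)‖) * ‖θ m‖ := by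
          refine (norm_sum_le _ _).trans (Finset.sum_le_sum fun k _ =>
            (norm_sum_le _ _).trans (Finset.sum_le_sum fun m _ => ?_))
          simp only [norm_mul, RCLike.norm_conj, Complex.norm_I, Complex.norm_intCast, one_mul]
          have := norm_nonneg (θ k)
          have h0 : 0 ≤ ‖θ k‖ * (‖V (k - m)‖ * ‖θ m‖) := by positivity
          nlinarith
      _ ≤ _ := by
          refine (sum_sum_mul_le (box N) (box N) (x := fun k => ‖θ k‖) (y := fun k => ‖θ k‖)
            (c := fun j => (1 + |(j : ℝ)|) * ‖V j‖) (fun _ => by positivity) hV).trans ?_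
          rw [mul_assoc, Real.mul_self_sqrt (Finset.sum_nonneg fun _ _ => sq_nonneg _)]
          rfl
  rw [h1]
  linarith [abs_nonneg S.re]

/-! ### The energy estimate for the system of Fourier coefficients -/

/-- The symbol `1 + 4π²dk²` of `1 - d∂²`. -/
def symb (d : ℝ) (k : ℤ) : ℝ := 1 + 4 * Real.pi ^ 2 * d * (k : ℝ) ^ 2

/-- The right-hand side of the first equation, `ζ_t = -κ u_x - l (ζu)_x`. -/
def rhsZ (κ l : ℝ) (a b : ℤ → ℂ) (k : ℤ) : ℂ :=
  -(2 * Real.pi * Complex.I * k) * (κ * b k + l * conv a b k)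

/-- The right-hand side of the second equation, `u_t = -(1 - d∂²)⁻¹(κ ζ_x + l/2 (u²)_x)`. -/
def rhsU (κ l d : ℝ) (a b : ℤ → ℂ) (k : ℤ) : ℂ :=
  -(2 * Real.pi * Complex.I * k) * (κ * a k + l / 2 * conv b b k) / (symb d k : ℂ)

/-- The energy `‖θ‖² + ‖ξ‖² + d‖ξ_x‖²` of a pair of trigonometric polynomials. -/
def energy (d : ℝ) (N : ℕ) (θ ξ : ℤ → ℂ) : ℝ :=
  ∑ k ∈ box N, (‖θ k‖ ^ 2 + symb d k * ‖ξ k‖ ^ 2)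

/-- The real part of `-(g_x, x)`. -/
def fluxPairing (N : ℕ) (x g : ℤ → ℂ) : ℝ :=
  ∑ k ∈ box N, ((starRingEnd ℂ) (x k) * (-(2 * Real.pi * Complex.I * k) * g k)).re

lemma one_le_symb {d : ℝ} (hd : 0 < d) (k : ℤ) : 1 ≤ symb d k := by
  have : 0 ≤ 4 * Real.pi ^ 2 * d * (k : ℝ) ^ 2 := by positivity
  simp only [symb]; linarith

lemma symb_pos {d : ℝ} (hd : 0 < d) (k : ℤ) : 0 < symb d k := one_pos.trans_le (one_le_symb hd k)

lemma energy_nonneg {d : ℝ} (hd : 0 < d) (N : ℕ) (θ ξ : ℤ → ℂ) : 0 ≤ energy d N θ ξ :=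
  Finset.sum_nonneg fun k _ => by have := symb_pos hd k; positivity

lemma sum_sq_fst_le_energy {d : ℝ} (hd : 0 < d) (N : ℕ) (θ ξ : ℤ → ℂ) :
    ∑ k ∈ box N, ‖θ k‖ ^ 2 ≤ energy d N θ ξ :=
  Finset.sum_le_sum fun k _ => by
    have := symb_pos hd k
    exact le_add_of_nonneg_right (by positivity)

lemma sum_sq_snd_le_energy {d : ℝ} (hd : 0 < d) (N : ℕ) (θ ξ : ℤ → ℂ) :
    ∑ k ∈ box N, ‖ξ k‖ ^ 2 ≤ energy d N θ ξ :=
  Finset.sum_le_sum fun k _ => by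
    have := mul_le_mul_of_nonneg_right (one_le_symb hd k) (sq_nonneg ‖ξ k‖)
    nlinarith [sq_nonneg ‖θ k‖]

/-- The d-weighted energy dominates the H¹ norm; B depends only on d, which keeps the later
constants independent of N. -/
lemma exists_weight_le_symb {d : ℝ} (hd : 0 < d) :
    ∃ B : ℝ, 0 ≤ B ∧ ∀ k : ℤ, (1 + |(k : ℝ)|) ^ 2 ≤ B ^ 2 * symb d k := by
  have hc : 0 < 4 * Real.pi ^ 2 * d := by positivity
  refine ⟨√(2 * (1 + 1 / (4 * Real.pi ^ 2 * d))), Real.sqrt_nonneg _, fun k => ?_⟩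
  rw [Real.sq_sqrt (by positivity), symb]
  have h1 : (1 + |(k : ℝ)|) ^ 2 ≤ 2 * (1 + (k : ℝ) ^ 2) := by
    nlinarith [sq_nonneg (1 - |(k : ℝ)|), sq_abs (k : ℝ)]
  have h2 : (1 + 1 / (4 * Real.pi ^ 2 * d)) * (1 + 4 * Real.pi ^ 2 * d * (k : ℝ) ^ 2)
      = 1 + (k : ℝ) ^ 2 + (4 * Real.pi ^ 2 * d * (k : ℝ) ^ 2 + 1 / (4 * Real.pi ^ 2 * d)) := by
    field_simp; ring
  have h3 : 0 ≤ 4 * Real.pi ^ 2 * d * (k : ℝ) ^ 2 + 1 / (4 * Real.pi ^ 2 * d) := by positivity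
  nlinarith

lemma hsq_eq_sum {N : ℕ} {a : ℤ → ℂ} (h : ∀ k ∉ box N, a k = 0) :
    hsq a = ∑ k ∈ box N, ((1 + |(k : ℝ)|) * ‖a k‖) ^ 2 :=
  tsum_eq_sum fun k hk => by simp [h k hk]

lemma sqrt_hsq_snd_le {d B : ℝ} (hB0 : 0 ≤ B)
    (hB : ∀ k : ℤ, (1 + |(k : ℝ)|) ^ 2 ≤ B ^ 2 * symb d k) {N : ℕ} {ξ : ℤ → ℂ} (θ : ℤ → ℂ)
    (hξ : ∀ k ∉ box N, ξ k = 0) : √(hsq ξ) ≤ B * √(energy d N θ ξ) := by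
  have h : hsq ξ ≤ B ^ 2 * energy d N θ ξ := by
    rw [hsq_eq_sum hξ, energy, Finset.mul_sum]
    refine Finset.sum_le_sum fun k _ => ?_
    rw [mul_pow]
    have := mul_le_mul_of_nonneg_right (hB k) (sq_nonneg ‖ξ k‖)
    nlinarith [mul_nonneg (sq_nonneg B) (sq_nonneg ‖θ k‖)]
  calc √(hsq ξ) ≤ √(B ^ 2 * energy d N θ ξ) := Real.sqrt_le_sqrt h
    _ = _ := by rw [Real.sqrt_mul (sq_nonneg B), Real.sqrt_sq hB0]

/-- The inverse inequality `|ξ_x|_∞ ≲ N^{1/2} ‖ξ_x‖`. -/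
lemma wnorm_le_sqrt_hsq {N : ℕ} (hN : 1 ≤ N) {ξ : ℤ → ℂ} (hξ : ∀ k ∉ box N, ξ k = 0) :
    wnorm ξ ≤ √(3 * N) * √(hsq ξ) := by
  have h1 : wnorm ξ = ∑ k ∈ box N, (1 + |(k : ℝ)|) * ‖ξ k‖ :=
    tsum_eq_sum fun k hk => by simp [hξ k hk]
  have hN' : (1 : ℝ) ≤ N := by exact_mod_cast hN
  rw [h1, hsq_eq_sum hξ, ← Real.sqrt_mul (by positivity)]
  refine Real.le_sqrt_of_sq_le (sq_sum_le_card_mul_sum_sq.trans ?_)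
  refine mul_le_mul_of_nonneg_right ?_ (Finset.sum_nonneg fun _ _ => sq_nonneg _)
  rw [card_box]; push_cast; linarith

lemma fluxPairing_add (N : ℕ) (x g h : ℤ → ℂ) :
    fluxPairing N x (g + h) = fluxPairing N x g + fluxPairing N x h := by
  simp only [fluxPairing, ← Finset.sum_add_distrib, ← Complex.add_re]
  refine Finset.sum_congr rfl fun k _ => ?_
  simp only [Pi.add_apply]; ring_nf

lemma fluxPairing_smul (N : ℕ) (x g : ℤ → ℂ) (s : ℝ) :
    fluxPairing N x ((s : ℂ) • g) = s * fluxPairing N x g := by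
  simp only [fluxPairing, Finset.mul_sum, ← Complex.re_ofReal_mul]
  refine Finset.sum_congr rfl fun k _ => ?_
  simp only [Pi.smul_apply, smul_eq_mul]; ring_nf

lemma fluxPairing_sub (N : ℕ) (x g h : ℤ → ℂ) :
    fluxPairing N x (g - h) = fluxPairing N x g - fluxPairing N x h := by
  simp only [fluxPairing, ← Finset.sum_sub_distrib, ← Complex.sub_re]
  refine Finset.sum_congr rfl fun k _ => ?_
  simp only [Pi.sub_apply]; ring_nf

lemma abs_fluxPairing_le (N : ℕ) (x g : ℤ → ℂ) :
    |fluxPairing N x g| ≤ 2 * Real.pi * ∑ k ∈ box N, ‖x k‖ * (|(k : ℝ)| * ‖g k‖) := by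
  rw [Finset.mul_sum]
  refine (Finset.abs_sum_le_sum_abs _ _).trans (Finset.sum_le_sum fun k _ => ?_)
  refine (Complex.abs_re_le_norm _).trans (le_of_eq ?_)
  simp only [norm_mul, norm_neg, RCLike.norm_conj, Complex.norm_I, Complex.norm_intCast,
    Complex.norm_real, Complex.norm_ofNat, Real.norm_eq_abs, abs_of_pos Real.pi_pos]
  ring

lemma abs_fluxPairing_conv_le (N : ℕ) (x : ℤ → ℂ) {c y : ℤ → ℂ} (hc : WSummable c)
    (hy : WSummable y) :
    |fluxPairing N x (conv c y)|
      ≤ 2 * Real.pi * (wnorm c * √(∑ k ∈ box N, ‖x k‖ ^ 2) * √(hsq y)) :=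
  (abs_fluxPairing_le N x _).trans
    (mul_le_mul_of_nonneg_left (sum_mul_conv_le _ _ hc hy) (by positivity))

lemma abs_fluxPairing_conv_self_le {N : ℕ} {V θ : ℤ → ℂ} (hV : WSummable V) (hVH : Hermitian V)
    (hθ : ∀ k ∉ box N, θ k = 0) :
    |fluxPairing N θ (conv V θ)| ≤ 2 * Real.pi * (wnorm V * ∑ k ∈ box N, ‖θ k‖ ^ 2) := by
  have : fluxPairing N θ (conv V θ) = -(2 * Real.pi) *
      ∑ k ∈ box N, ((starRingEnd ℂ) (θ k) * (Complex.I * k * conv V θ k)).re := by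
    rw [fluxPairing, Finset.mul_sum]
    refine Finset.sum_congr rfl fun k _ => ?_
    rw [← Complex.re_ofReal_mul]
    congr 1; push_cast; ring
  rw [this, abs_mul, abs_neg, abs_of_pos Real.two_pi_pos]
  exact mul_le_mul_of_nonneg_left (abs_re_skew_le hV hVH hθ) (by positivity)

/-- This and the next bound serve the linear coupling terms. The derivative is charged to ξ in both
equations, so no cancellation between the κ₁ and κ₂ terms is needed. -/
lemma abs_fluxPairing_le_left {N : ℕ} {x : ℤ → ℂ} (hx : ∀ k ∉ box N, x k = 0) (g : ℤ → ℂ) :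
    |fluxPairing N x g| ≤ 2 * Real.pi * (√(hsq x) * √(∑ k ∈ box N, ‖g k‖ ^ 2)) := by
  refine (abs_fluxPairing_le N x g).trans (mul_le_mul_of_nonneg_left ?_ (by positivity))
  rw [hsq_eq_sum hx]
  refine le_trans (Finset.sum_le_sum fun k _ => ?_) (Real.sum_mul_le_sqrt_mul_sqrt _ _ _)
  nlinarith [mul_nonneg (norm_nonneg (x k)) (norm_nonneg (g k))]

lemma abs_fluxPairing_le_right {N : ℕ} {g : ℤ → ℂ} (hg : ∀ k ∉ box N, g k = 0) (x : ℤ → ℂ) :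
    |fluxPairing N x g| ≤ 2 * Real.pi * (√(∑ k ∈ box N, ‖x k‖ ^ 2) * √(hsq g)) := by
  refine (abs_fluxPairing_le N x g).trans (mul_le_mul_of_nonneg_left ?_ (by positivity))
  rw [hsq_eq_sum hg]
  refine le_trans (Finset.sum_le_sum fun k _ => ?_) (Real.sum_mul_le_sqrt_mul_sqrt _ _ _)
  nlinarith [mul_nonneg (norm_nonneg (x k)) (norm_nonneg (g k))]

/-- The rate of change of half the energy of `(θ, ξ)` when `θ' = rhsZ (a', b') - rhsZ (a, b)` and
`ξ' = rhsU (a', b') - rhsU (a, b)`. -/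
def energyRate (κ₁ κ₂ l d : ℝ) (N : ℕ) (θ ξ a' b' a b : ℤ → ℂ) : ℝ :=
  ∑ k ∈ box N, (((starRingEnd ℂ) (θ k) * (rhsZ κ₁ l a' b' k - rhsZ κ₁ l a b k)).re
    + symb d k * ((starRingEnd ℂ) (ξ k) * (rhsU κ₂ l d a' b' k - rhsU κ₂ l d a b k)).re)

/-- With A, B the truncations and z, w the errors, the only product containing z keeps the full
approximation B + w as its coefficient, the form antisymmetry needs. The last two products contain
the truncation errors and drive the estimate. -/
lemma conv_truncation {a b A B z w : ℤ → ℂ} (ha : WSummable a) (hb : WSummable b)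
    (hA : WSummable A) (hB : WSummable B) (hz : WSummable z) (hw : WSummable w) :
    conv (A + z) (B + w) - conv a b
      = conv A w + conv (B + w) z - conv A (b - B) - conv b (a - A) := by
  have h1 : conv (A + z) (B + w) = conv A B + conv A w + conv (B + w) z := by
    rw [add_conv hA hz (hB.add hw), conv_add hA hB hw, conv_comm z]
  have h2 : conv a b = conv A B + conv A (b - B) + conv b (a - A) := by
    have e1 : conv A b = conv A B + conv A (b - B) := by
      rw [← conv_add hA hB (hb.sub hB), add_sub_cancel]
    have e2 : conv b a = conv b A + conv b (a - A) := by
      rw [← conv_add hb hA (ha.sub hA), add_sub_cancel]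
    rw [conv_comm a b, e2, conv_comm b A, e1]
  rw [h1, h2]; abel

/-- The weight `symb` in the energy cancels the inverse of 1 - d∂² in `rhsU`. A sequence agrees with
its truncation on `box N`, so the linear terms produce no truncation error. -/
lemma energyRate_eq {κ₁ κ₂ l d : ℝ} (hd : 0 < d) {N : ℕ} {a b z w : ℤ → ℂ} (θ ξ : ℤ → ℂ)
    (ha : WSummable a) (hb : WSummable b) (hz : WSummable z) (hw : WSummable w) :
    energyRate κ₁ κ₂ l d N θ ξ (trunc N a + z) (trunc N b + w) a b =
      κ₁ * fluxPairing N θ w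
      + l * (fluxPairing N θ (conv (trunc N a) w) + fluxPairing N θ (conv (trunc N b + w) z)
        - fluxPairing N θ (conv (trunc N a) (b - trunc N b))
        - fluxPairing N θ (conv b (a - trunc N a)))
      + (κ₂ * fluxPairing N ξ z
      + l / 2 * (fluxPairing N ξ (conv (trunc N b) w) + fluxPairing N ξ (conv (trunc N b + w) w)
        - fluxPairing N ξ (conv (trunc N b) (b - trunc N b))
        - fluxPairing N ξ (conv b (b - trunc N b)))) := by
  have hA := wSummable_trunc a N
  have hB := wSummable_trunc b N
  have h1 : ∑ k ∈ box N, ((starRingEnd ℂ) (θ k) * (rhsZ κ₁ l (trunc N a + z) (trunc N b + w) k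
        - rhsZ κ₁ l a b k)).re
      = fluxPairing N θ ((κ₁ : ℂ) • w + (l : ℂ) • (conv (trunc N a) w + conv (trunc N b + w) z
        - conv (trunc N a) (b - trunc N b) - conv b (a - trunc N a))) := by
    rw [← conv_truncation ha hb hA hB hz hw]
    refine Finset.sum_congr rfl fun k hk => ?_
    simp only [rhsZ, Pi.add_apply, Pi.smul_apply, Pi.sub_apply, smul_eq_mul, trunc_of_mem hk]
    ring_nf
  have h2 : ∑ k ∈ box N, symb d k * ((starRingEnd ℂ) (ξ k) *
        (rhsU κ₂ l d (trunc N a + z) (trunc N b + w) k - rhsU κ₂ l d a b k)).re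
      = fluxPairing N ξ ((κ₂ : ℂ) • z + ((l / 2 : ℝ) : ℂ) • (conv (trunc N b) w
        + conv (trunc N b + w) w
        - conv (trunc N b) (b - trunc N b) - conv b (b - trunc N b))) := by
    rw [← conv_truncation hb hb hB hB hw hw]
    refine Finset.sum_congr rfl fun k hk => ?_
    have hs : (symb d k : ℂ) ≠ 0 := by exact_mod_cast (symb_pos hd k).ne'
    rw [← Complex.re_ofReal_mul]
    simp only [rhsU, Pi.add_apply, Pi.smul_apply, Pi.sub_apply, smul_eq_mul, trunc_of_mem hk]
    congr 1
    push_cast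
    field_simp
    ring
  rw [energyRate, Finset.sum_add_distrib, h1, h2]
  simp only [fluxPairing_add, fluxPairing_sub, fluxPairing_smul]

set_option maxHeartbeats 1000000 in
-- The scalar s is the value of the cut-off: the equations see the damped errors sθ, sξ, while the
-- energy is that of θ, ξ. The constant K is chosen before N, and the condition on s² N E makes the
-- inverse inequality for sξ uniform in N.
lemma energyRate_le {κ₁ κ₂ l d M : ℝ} (hd : 0 < d) (hM : 0 ≤ M) :
    ∃ K : ℝ, 0 ≤ K ∧ ∀ (N : ℕ) (a b θ ξ : ℤ → ℂ) (s τ : ℝ), 1 ≤ N →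
      WSummable a → WSummable b → Hermitian b → Hermitian ξ → wnorm a ≤ M → wnorm b ≤ M →
      (∀ k ∉ box N, θ k = 0) → (∀ k ∉ box N, ξ k = 0) → 0 ≤ s → s ≤ 1 → 0 ≤ τ →
      s ^ 2 * (N * energy d N θ ξ) ≤ 2 →
      √(hsq (a - trunc N a)) ≤ τ → √(hsq (b - trunc N b)) ≤ τ →
      energyRate κ₁ κ₂ l d N θ ξ (trunc N a + (s : ℂ) • θ) (trunc N b + (s : ℂ) • ξ) a b
        ≤ K * (energy d N θ ξ + τ * √(energy d N θ ξ)) := by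
  obtain ⟨B, hB0, hB⟩ := exists_weight_le_symb hd
  set W : ℝ := M + 3 * B with hW
  have hpi := Real.pi_pos
  refine ⟨2 * Real.pi * (|κ₁| * B + |l| * (M * B + W + 2 * M) + |κ₂| * B
    + |l| / 2 * (M * B + W * B + 2 * M)), by positivity, ?_⟩
  intro N a b θ ξ s τ hN ha hb hbH hξH haM hbM hθ hξ hs0 hs1 hτ hsE hρ hσ
  set e : ℝ := √(energy d N θ ξ) with he
  have hE : e ^ 2 = energy d N θ ξ := Real.sq_sqrt (energy_nonneg hd N θ ξ)
  have he0 : 0 ≤ e := Real.sqrt_nonneg _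
  have hz : WSummable ((s : ℂ) • θ) := (wSummable_of_support hθ).smul _
  have hw : WSummable ((s : ℂ) • ξ) := (wSummable_of_support hξ).smul _
  have hA := wSummable_trunc a N
  have hBt := wSummable_trunc b N
  have hθe : √(∑ k ∈ box N, ‖θ k‖ ^ 2) ≤ e := Real.sqrt_le_sqrt (sum_sq_fst_le_energy hd N θ ξ)
  have hξe : √(∑ k ∈ box N, ‖ξ k‖ ^ 2) ≤ e := Real.sqrt_le_sqrt (sum_sq_snd_le_energy hd N θ ξ)
  have hξh : √(hsq ξ) ≤ B * e := sqrt_hsq_snd_le hB0 hB θ hξ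
  have hAM : wnorm (trunc N a) ≤ M := (wnorm_trunc_le ha N).trans haM
  have hBM : wnorm (trunc N b) ≤ M := (wnorm_trunc_le hb N).trans hbM
  -- The square of s√(3N)e is 3·s²NE ≤ 6, below 3².
  have hsξ : s * wnorm ξ ≤ 3 * B := by
    have h1 : s * √(3 * N) * e ≤ 3 := by
      refine abs_le_of_sq_le_sq' ?_ (by norm_num) |>.2
      rw [mul_pow, mul_pow, Real.sq_sqrt (by positivity), hE]
      nlinarith
    calc s * wnorm ξ ≤ s * (√(3 * N) * (B * e)) :=
          mul_le_mul_of_nonneg_left ((wnorm_le_sqrt_hsq hN hξ).trans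
            (mul_le_mul_of_nonneg_left hξh (Real.sqrt_nonneg _))) hs0
      _ = (s * √(3 * N) * e) * B := by ring
      _ ≤ 3 * B := mul_le_mul_of_nonneg_right h1 hB0
  have hVW : wnorm (trunc N b + (s : ℂ) • ξ) ≤ W := by
    refine (wnorm_add_le hBt hw).trans (add_le_add hBM ?_)
    rwa [wnorm_smul, Complex.norm_real, Real.norm_of_nonneg hs0]
  have hVH : Hermitian (trunc N b + (s : ℂ) • ξ) := (hbH.trunc N).add (hξH.real_smul s)
  have hW0 : 0 ≤ W := by positivity
  have key : ∀ (x c y : ℤ → ℂ) {m n : ℝ}, WSummable c → WSummable y →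
      √(∑ k ∈ box N, ‖x k‖ ^ 2) ≤ e → wnorm c ≤ m → √(hsq y) ≤ n →
      |fluxPairing N x (conv c y)| ≤ 2 * Real.pi * (m * e * n) := by
    intro x c y m n hc hy hx hm hn
    refine (abs_fluxPairing_conv_le N x hc hy).trans (mul_le_mul_of_nonneg_left ?_ (by positivity))
    have h0 := wnorm_nonneg c
    have h1 := Real.sqrt_nonneg (hsq y)
    have h2 := h0.trans hm
    gcongr
  have key' : ∀ {r R : ℝ}, |r| ≤ R → |s * r| ≤ R := by
    intro r R h
    rw [abs_mul, abs_of_nonneg hs0]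
    nlinarith [abs_nonneg r]
  have t1 : |fluxPairing N θ ((s : ℂ) • ξ)| ≤ 2 * Real.pi * (B * e ^ 2) := by
    rw [fluxPairing_smul]
    refine key' ((abs_fluxPairing_le_right hξ θ).trans (mul_le_mul_of_nonneg_left ?_ (by positivity)))
    calc _ ≤ e * (B * e) := by gcongr
      _ = _ := by ring
  have t2 : |fluxPairing N θ (conv (trunc N a) ((s : ℂ) • ξ))| ≤ 2 * Real.pi * (M * B * e ^ 2) := by
    rw [conv_smul, fluxPairing_smul]
    refine key' ((key θ _ ξ hA (wSummable_of_support hξ) hθe hAM hξh).trans (le_of_eq (by ring)))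
  -- The critical term: both remaining factors are θ, which has no H¹ bound, so the skew estimate is
  -- used instead of `key`.
  have t3 : |fluxPairing N θ (conv (trunc N b + (s : ℂ) • ξ) ((s : ℂ) • θ))|
      ≤ 2 * Real.pi * (W * e ^ 2) := by
    rw [conv_smul, fluxPairing_smul]
    refine key' ((abs_fluxPairing_conv_self_le (hBt.add hw) hVH hθ).trans
      (mul_le_mul_of_nonneg_left ?_ (by positivity)))
    rw [hE]
    exact mul_le_mul hVW (sum_sq_fst_le_energy hd N θ ξ)
      (Finset.sum_nonneg fun _ _ => sq_nonneg _) hW0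
  have t4 : |fluxPairing N θ (conv (trunc N a) (b - trunc N b))| ≤ 2 * Real.pi * (M * e * τ) :=
    key θ _ _ hA (hb.sub hBt) hθe hAM hσ
  have t5 : |fluxPairing N θ (conv b (a - trunc N a))| ≤ 2 * Real.pi * (M * e * τ) :=
    key θ _ _ hb (ha.sub hA) hθe hbM hρ
  have t6 : |fluxPairing N ξ ((s : ℂ) • θ)| ≤ 2 * Real.pi * (B * e ^ 2) := by
    rw [fluxPairing_smul]
    refine key' ((abs_fluxPairing_le_left hξ θ).trans (mul_le_mul_of_nonneg_left ?_ (by positivity)))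
    calc _ ≤ (B * e) * e := by gcongr
      _ = _ := by ring
  have t7 : |fluxPairing N ξ (conv (trunc N b) ((s : ℂ) • ξ))| ≤ 2 * Real.pi * (M * B * e ^ 2) := by
    rw [conv_smul, fluxPairing_smul]
    refine key' ((key ξ _ ξ hBt (wSummable_of_support hξ) hξe hBM hξh).trans (le_of_eq (by ring)))
  have t8 : |fluxPairing N ξ (conv (trunc N b + (s : ℂ) • ξ) ((s : ℂ) • ξ))|
      ≤ 2 * Real.pi * (W * B * e ^ 2) := by
    rw [conv_smul, fluxPairing_smul]
    refine key' ((key ξ _ ξ (hBt.add hw) (wSummable_of_support hξ) hξe hVW hξh).trans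
      (le_of_eq (by ring)))
  have t9 : |fluxPairing N ξ (conv (trunc N b) (b - trunc N b))| ≤ 2 * Real.pi * (M * e * τ) :=
    key ξ _ _ hBt (hb.sub hBt) hξe hBM hσ
  have t10 : |fluxPairing N ξ (conv b (b - trunc N b))| ≤ 2 * Real.pi * (M * e * τ) :=
    key ξ _ _ hb (hb.sub hBt) hξe hbM hσ
  rw [energyRate_eq hd θ ξ ha hb hz hw]
  have mulle : ∀ {c r R : ℝ}, |r| ≤ R → c * r ≤ |c| * R := fun {c r R} h =>
    (le_abs_self _).trans (by rw [abs_mul]; exact mul_le_mul_of_nonneg_left h (abs_nonneg c))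
  have comb : ∀ {p q r v P Q R S : ℝ}, |p| ≤ P → |q| ≤ Q → |r| ≤ R → |v| ≤ S →
      |p + q - r - v| ≤ P + Q + R + S := fun {p q r v P Q R S} h1 h2 h3 h4 => by
    rw [abs_le] at *
    constructor <;> linarith [h1.1, h1.2, h2.1, h2.2, h3.1, h3.2, h4.1, h4.2]
  have hl2 : |l / 2| = |l| / 2 := by rw [abs_div, abs_two]
  refine (add_le_add (add_le_add (mulle t1) (mulle (comb t2 t3 t4 t5)))
    (add_le_add (mulle t6) (mulle (comb t7 t8 t9 t10)))).trans ?_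
  rw [hl2, ← hE]
  have hx : 0 ≤ Real.pi * e * τ := by positivity
  have hy : 0 ≤ Real.pi * e ^ 2 := by positivity
  -- In K(e² + τe) every coefficient multiplies both e² and τe, though each is needed with only one
  -- of them; `q1` and `q2` are the surplus.
  have q1 : 0 ≤ |l| * M * (Real.pi * e ^ 2) := by positivity
  have q2 : 0 ≤ (|κ₁| * B + |l| * (M * B + W) + |κ₂| * B + |l| / 2 * (M * B + W * B))
      * (Real.pi * e * τ) := by positivity
  linear_combination 2 * q2 + 6 * q1

/-! ### Fourier coefficients -/

lemma expo_eq_fourier (k : ℤ) (x : ℝ) : expo k x = fourier k (x : AddCircle ((1 : ℝ) - 0)) := by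
  rw [fourier_coe_apply, expo]; simp

lemma expo_add (k m : ℤ) (x : ℝ) : expo (k + m) x = expo k x * expo m x := by
  rw [expo, expo, expo, ← Complex.exp_add]; congr 1; push_cast; ring

lemma conj_expo (k : ℤ) (x : ℝ) : (starRingEnd ℂ) (expo k x) = expo (-k) x := by
  rw [expo, expo, ← Complex.exp_conj]; congr 1; simp [Complex.conj_ofNat]

lemma expo_zero (x : ℝ) : expo 0 x = 1 := by simp [expo]

lemma norm_expo (k : ℤ) (x : ℝ) : ‖expo k x‖ = 1 := by
  have : 2 * (Real.pi : ℂ) * Complex.I * k * x = ((2 * Real.pi * k * x : ℝ) : ℂ) * Complex.I := by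
    push_cast; ring
  rw [expo, this, Complex.norm_exp_ofReal_mul_I]

lemma expo_eq_cos_add_sin (k : ℤ) (x : ℝ) :
    expo k x = (Real.cos (2 * Real.pi * k * x) : ℂ) + (Real.sin (2 * Real.pi * k * x)) * Complex.I := by
  have : 2 * (Real.pi : ℂ) * Complex.I * k * x = ((2 * Real.pi * k * x : ℝ) : ℂ) * Complex.I := by
    push_cast; ring
  rw [expo, this, Complex.exp_mul_I, ← Complex.ofReal_cos, ← Complex.ofReal_sin]

lemma hasDerivAt_expo (k : ℤ) (x : ℝ) :
    HasDerivAt (expo k) (2 * Real.pi * Complex.I * k * expo k x) x := by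
  have h : HasDerivAt (fun y : ℂ => Complex.exp (2 * (Real.pi : ℂ) * Complex.I * k * y))
      (Complex.exp (2 * (Real.pi : ℂ) * Complex.I * k * x) * (2 * (Real.pi : ℂ) * Complex.I * k * 1))
      (x : ℂ) := ((hasDerivAt_id (x : ℂ)).const_mul _).cexp
  have := h.comp_ofReal
  rw [mul_one, mul_comm (Complex.exp _)] at this
  exact this

lemma contDiff_expo (k : ℤ) : ContDiff ℝ (⊤ : ℕ∞) (expo k) := by
  unfold expo
  exact (contDiff_const.mul Complex.ofRealCLM.contDiff).cexp

lemma continuous_expo (k : ℤ) : Continuous (expo k) := (contDiff_expo k).continuous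

lemma expo_periodic (k : ℤ) : Function.Periodic (expo k) 1 := by
  intro x
  rw [expo, expo, Complex.exp_eq_exp_iff_exists_int]
  exact ⟨k, by push_cast; ring⟩

lemma integral_expo (k : ℤ) : ∫ x in (0 : ℝ)..1, expo k x = if k = 0 then 1 else 0 := by
  split_ifs with h
  · simp [h, expo_zero]
  · have hc : 2 * (Real.pi : ℂ) * Complex.I * k ≠ 0 := by
      simp [Real.pi_ne_zero, h]
    have h1 := integral_exp_mul_complex (a := 0) (b := 1) hc
    have h2 : expo k 1 = 1 := by simpa [expo] using expo_periodic k 0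
    simp only [expo, Complex.ofReal_one] at h2
    simp only [expo]
    rw [h1]
    simp only [Complex.ofReal_one, h2]
    simp

lemma coeff_eq_integral (g : ℝ → ℝ) (k : ℤ) :
    coeff g k = ∫ x in (0 : ℝ)..1, expo (-k) x * (g x : ℂ) := by
  rw [coeff, fourierCoeffOn_eq_integral]
  simp [expo_eq_fourier]

lemma ip_expo (g : ℝ → ℝ) (k : ℤ) : ip g (expo k) = coeff g k := by
  rw [ip, coeff_eq_integral]
  simp only [conj_expo, mul_comm]

lemma coeff_hermitian (g : ℝ → ℝ) : Hermitian (coeff g) := by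
  intro k
  rw [coeff_eq_integral, coeff_eq_integral, ← intervalIntegral.intervalIntegral_conj]
  simp [conj_expo]

lemma coeff_congr_ae {f g : ℝ → ℝ} (h : f =ᵐ[volume] g) : coeff f = coeff g := by
  unfold coeff
  refine fourierCoeffOn_congr_ae _ (ae_restrict_of_ae ?_)
  filter_upwards [h] with x hx
  rw [hx]

lemma intervalIntegrable_of_memLp {g : ℝ → ℝ} (h : MemLp g 2 (volume.restrict (Ioc (0 : ℝ) 1))) :
    IntervalIntegrable g volume 0 1 := by
  rw [intervalIntegrable_iff_integrableOn_Ioc_of_le zero_le_one]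
  exact h.integrable (by norm_num)

lemma IntervalIntegrable.complex_ofReal {g : ℝ → ℝ} (h : IntervalIntegrable g volume 0 1) :
    IntervalIntegrable (fun x => (g x : ℂ)) volume 0 1 :=
  ⟨h.1.ofReal, h.2.ofReal⟩

lemma IntervalIntegrable.expo_mul {g : ℝ → ℝ} (h : IntervalIntegrable g volume 0 1) (k : ℤ) :
    IntervalIntegrable (fun x => expo k x * (g x : ℂ)) volume 0 1 :=
  (IntervalIntegrable.complex_ofReal h).continuousOn_mul (continuous_expo k).continuousOn

lemma coeff_add {f g : ℝ → ℝ} (hf : IntervalIntegrable f volume 0 1)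
    (hg : IntervalIntegrable g volume 0 1) : coeff (fun x => f x + g x) = coeff f + coeff g := by
  ext k
  simp only [Pi.add_apply, coeff_eq_integral]
  rw [← intervalIntegral.integral_add (IntervalIntegrable.expo_mul hf _)
    (IntervalIntegrable.expo_mul hg _)]
  simp [mul_add]

lemma coeff_const_mul (c : ℝ) (f : ℝ → ℝ) : coeff (fun x => c * f x) = (c : ℂ) • coeff f := by
  ext k
  simp only [Pi.smul_apply, coeff_eq_integral, smul_eq_mul]
  rw [← intervalIntegral.integral_const_mul]
  congr 1; ext x; push_cast; ring

lemma coeff_sub {f g : ℝ → ℝ} (hf : IntervalIntegrable f volume 0 1)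
    (hg : IntervalIntegrable g volume 0 1) : coeff (fun x => f x - g x) = coeff f - coeff g := by
  have h := coeff_add hf (hg.const_mul (-1))
  rw [coeff_const_mul] at h
  simpa [sub_eq_add_neg] using h

lemma memLp_ofReal {g : ℝ → ℝ} (h : MemLp g 2 (volume.restrict (Ioc (0 : ℝ) 1))) :
    MemLp (fun x => (g x : ℂ)) 2 (volume.restrict (Ioc (0 : ℝ) 1)) := h.ofReal

/-! ### Parseval, products and derivatives -/

/-- Parseval's identity. -/
lemma hasSum_sq_coeff {g : ℝ → ℝ} (h : MemLp g 2 (volume.restrict (Ioc (0 : ℝ) 1))) :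
    HasSum (fun k => ‖coeff g k‖ ^ 2) (∫ x in (0 : ℝ)..1, g x ^ 2) := by
  have := hasSum_sq_fourierCoeffOn (zero_lt_one (α := ℝ)) (memLp_ofReal h)
  simpa [coeff] using this

/-- Parseval's identity in bilinear form. -/
lemma hasSum_conj_fourierCoeffOn_mul {a b : ℝ} {f g : ℝ → ℂ} (hab : a < b)
    (hf : MemLp f 2 (volume.restrict (Ioc a b))) (hg : MemLp g 2 (volume.restrict (Ioc a b))) :
    HasSum (fun i => (starRingEnd ℂ) (fourierCoeffOn hab f i) * fourierCoeffOn hab g i)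
      ((b - a)⁻¹ • ∫ x in a..b, (starRingEnd ℂ) (f x) * g x) := by
  have := Fact.mk (by linarith : 0 < b - a)
  -- The right end point is written a + (b - a), the form required for lifting to the circle of
  -- length b - a.
  rw [← add_sub_cancel a b] at hf hg
  have hF := hf.memLp_liftIoc.haarAddCircle
  have hG := hg.memLp_liftIoc.haarAddCircle
  have key := fourierBasis.hasSum_inner_mul_inner hF.toLp hG.toLp
  have e1 : ∀ i, (starRingEnd ℂ) (fourierCoeffOn hab f i) * fourierCoeffOn hab g i
      = inner ℂ hF.toLp (fourierBasis i) * inner ℂ (fourierBasis i) hG.toLp := by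
    intro i
    rw [← inner_conj_symm, ← HilbertBasis.repr_apply_apply, ← HilbertBasis.repr_apply_apply,
      fourierBasis_repr, fourierBasis_repr, fourierCoeff_congr_ae hF.coeFn_toLp,
      fourierCoeff_congr_ae hG.coeFn_toLp, fourierCoeff_liftIoc_eq, fourierCoeff_liftIoc_eq]
    simp
  have e2 : (b - a)⁻¹ • ∫ x in a..b, (starRingEnd ℂ) (f x) * g x = inner ℂ hF.toLp hG.toLp := by
    rw [MeasureTheory.L2.inner_def]
    nth_rw 2 [← add_sub_cancel a b]
    rw [← AddCircle.integral_liftIoc_eq_intervalIntegral, ← AddCircle.integral_haarAddCircle]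
    apply integral_congr_ae
    filter_upwards [hF.coeFn_toLp, hG.coeFn_toLp] with x hx hy
    rw [hx, hy]
    simp only [RCLike.inner_apply']
    rfl
  rw [e2]
  exact key.congr_fun e1

/-- The Fourier coefficients of a product. -/
lemma coeff_mul {f g : ℝ → ℝ} (hf : MemLp f 2 (volume.restrict (Ioc (0 : ℝ) 1)))
    (hg : MemLp g 2 (volume.restrict (Ioc (0 : ℝ) 1))) :
    coeff (fun x => f x * g x) = conv (coeff f) (coeff g) := by
  ext k
  -- Bilinear Parseval is applied to e_k f and g: for real f the conjugate of the m-th coefficient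
  -- of e_k f is the coefficient of f at k - m.
  have hF : MemLp (fun x => expo k x * (f x : ℂ)) 2 (volume.restrict (Ioc (0 : ℝ) 1)) :=
    (memLp_ofReal hf).of_le
      ((continuous_expo k).aestronglyMeasurable.mul (memLp_ofReal hf).aestronglyMeasurable)
      (ae_of_all _ fun x => by rw [norm_mul, norm_expo, one_mul])
  have h := hasSum_conj_fourierCoeffOn_mul zero_lt_one hF (memLp_ofReal hg)
  have h1 : ∀ m, fourierCoeffOn (zero_lt_one (α := ℝ)) (fun x => expo k x * (f x : ℂ)) m
      = coeff f (m - k) := by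
    intro m
    rw [coeff_eq_integral, fourierCoeffOn_eq_integral]
    simp only [sub_zero, div_one, one_smul, smul_eq_mul]
    refine intervalIntegral.integral_congr fun x _ => ?_
    have := expo_eq_fourier (-m) x
    rw [← this, ← mul_assoc, ← expo_add]
    congr 2; ring
  rw [conv, coeff_eq_integral]
  convert h.tsum_eq.symm using 1
  · simp only [sub_zero, inv_one, one_smul]
    refine intervalIntegral.integral_congr fun x _ => ?_
    simp only [map_mul, conj_expo, Complex.conj_ofReal, Complex.ofReal_mul]
    ring
  · refine tsum_congr fun m => ?_
    rw [h1, ← coeff_hermitian, neg_sub]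
    rfl

/-- The Fourier coefficients of a derivative. -/
lemma coeff_deriv {g : ℝ → ℝ} (hg : ContDiff ℝ 1 g) (hp : Function.Periodic g 1) (k : ℤ) :
    coeff (deriv g) k = 2 * Real.pi * Complex.I * k * coeff g k := by
  have hd : ∀ x, HasDerivAt g (deriv g x) x := fun x =>
    (hg.differentiable one_ne_zero x).hasDerivAt
  have hc : Continuous (deriv g) := hg.continuous_deriv le_rfl
  have h := intervalIntegral.integral_mul_deriv_eq_deriv_mul (a := 0) (b := 1)
    (u := expo (-k)) (v := fun x => (g x : ℂ))
    (u' := fun x => 2 * Real.pi * Complex.I * (-k : ℤ) * expo (-k) x)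
    (v' := fun x => ((deriv g x : ℝ) : ℂ))
    (fun x _ => hasDerivAt_expo (-k) x) (fun x _ => (hd x).ofReal_comp)
    ((continuous_const.mul (continuous_expo _)).intervalIntegrable _ _)
    ((Complex.continuous_ofReal.comp hc).intervalIntegrable _ _)
  have e1 : expo (-k) 1 = expo (-k) 0 := by simpa using expo_periodic (-k) 0
  have e2 : g 1 = g 0 := by simpa using hp 0
  rw [coeff_eq_integral, h, e1, e2, sub_self, coeff_eq_integral, zero_sub,
    ← intervalIntegral.integral_const_mul, ← intervalIntegral.integral_neg]
  congr 1; ext x; push_cast; ring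

lemma coeff_eq_cos_sin {g : ℝ → ℝ} (hg : IntervalIntegrable g volume 0 1) (k : ℤ) :
    coeff g k = ((∫ x in (0 : ℝ)..1, g x * Real.cos (2 * Real.pi * k * x) : ℝ) : ℂ)
      - ((∫ x in (0 : ℝ)..1, g x * Real.sin (2 * Real.pi * k * x) : ℝ) : ℂ) * Complex.I := by
  have hc : IntervalIntegrable (fun x => g x * Real.cos (2 * Real.pi * k * x)) volume 0 1 :=
    hg.mul_continuousOn (by fun_prop)
  have hs : IntervalIntegrable (fun x => g x * Real.sin (2 * Real.pi * k * x)) volume 0 1 :=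
    hg.mul_continuousOn (by fun_prop)
  rw [coeff_eq_integral, ← intervalIntegral.integral_ofReal, ← intervalIntegral.integral_ofReal,
    ← intervalIntegral.integral_mul_const,
    ← intervalIntegral.integral_sub (IntervalIntegrable.complex_ofReal hc)
      ((IntervalIntegrable.complex_ofReal hs).mul_const _)]
  congr 1; ext x
  rw [expo_eq_cos_add_sin]
  have : 2 * Real.pi * ((-k : ℤ) : ℝ) * x = -(2 * Real.pi * k * x) := by push_cast; ring
  rw [this, Real.cos_neg, Real.sin_neg]
  push_cast; ring

lemma integral_mul_cos {g : ℝ → ℝ} (hg : IntervalIntegrable g volume 0 1) (k : ℤ) :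
    ∫ x in (0 : ℝ)..1, g x * Real.cos (2 * Real.pi * k * x) = (coeff g k).re := by
  rw [coeff_eq_cos_sin hg]; simp

lemma integral_mul_sin {g : ℝ → ℝ} (hg : IntervalIntegrable g volume 0 1) (k : ℤ) :
    ∫ x in (0 : ℝ)..1, g x * Real.sin (2 * Real.pi * k * x) = -(coeff g k).im := by
  rw [coeff_eq_cos_sin hg]; simp

/-! ### Trigonometric polynomials -/

/-- The trigonometric polynomial with coefficients `c`. -/
def trigPoly (N : ℕ) (c : ℤ → ℂ) (x : ℝ) : ℂ := ∑ k ∈ box N, c k * expo k x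

lemma proj_eq_trigPoly (N : ℕ) (g : ℝ → ℝ) : proj N g = trigPoly N (coeff g) := rfl

lemma mem_trigSpace_iff {N : ℕ} {φ : ℝ → ℂ} :
    φ ∈ trigSpace N ↔ ∃ c : ℤ → ℂ, φ = trigPoly N c := by
  have hc : Icc (-(N : ℤ)) (N : ℤ) = (box N : Set ℤ) := (Finset.coe_Icc _ _).symm
  constructor
  · intro h
    rw [trigSpace, hc] at h
    obtain ⟨c, hc'⟩ := (Submodule.mem_span_image_finset_iff_exists_fun' ℂ).1 h
    refine ⟨c, ?_⟩
    rw [← hc']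
    ext x
    simp [trigPoly]
  · rintro ⟨c, rfl⟩
    have : trigPoly N c = ∑ k ∈ box N, c k • expo k := by ext x; simp [trigPoly]
    rw [this, trigSpace, hc]
    exact Submodule.sum_mem _ fun k hk => Submodule.smul_mem _ _
      (Submodule.subset_span ⟨k, hk, rfl⟩)

lemma integral_expo_mul_trigPoly (N : ℕ) (c : ℤ → ℂ) (k : ℤ) :
    ∫ x in (0 : ℝ)..1, expo (-k) x * trigPoly N c x = trunc N c k := by
  have : ∀ x, expo (-k) x * trigPoly N c x = ∑ m ∈ box N, c m * expo (m - k) x := by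
    intro x
    rw [trigPoly, Finset.mul_sum]
    refine Finset.sum_congr rfl fun m _ => ?_
    rw [sub_eq_add_neg, expo_add]; ring
  simp only [this]
  rw [intervalIntegral.integral_finsetSum (fun m _ => Continuous.intervalIntegrable
    (by have := continuous_expo (m - k); fun_prop) _ _)]
  simp only [intervalIntegral.integral_const_mul, integral_expo, sub_eq_zero]
  simp [trunc]

lemma coeff_of_eq_trigPoly {N : ℕ} {g : ℝ → ℝ} {c : ℤ → ℂ} (h : ∀ x, (g x : ℂ) = trigPoly N c x) :
    coeff g = trunc N c := by
  ext k
  simp only [coeff_eq_integral, h, integral_expo_mul_trigPoly]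

lemma trigPoly_trunc (N : ℕ) (c : ℤ → ℂ) : trigPoly N (trunc N c) = trigPoly N c := by
  ext x
  exact Finset.sum_congr rfl fun k hk => by rw [trunc_of_mem hk]

lemma MemTrig.eq_trigPoly {N : ℕ} {g : ℝ → ℝ} (h : MemTrig N g) (x : ℝ) :
    (g x : ℂ) = trigPoly N (coeff g) x := by
  obtain ⟨c, hc⟩ := mem_trigSpace_iff.1 h
  have hc' : ∀ x, (g x : ℂ) = trigPoly N c x := fun x => congrFun hc x
  rw [coeff_of_eq_trigPoly hc', trigPoly_trunc, hc']

lemma MemTrig.coeff_eq_zero {N : ℕ} {g : ℝ → ℝ} (h : MemTrig N g) : ∀ k ∉ box N, coeff g k = 0 := by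
  intro k hk
  rw [coeff_of_eq_trigPoly h.eq_trigPoly, trunc_of_notMem hk]

lemma MemTrig.of_trigPoly {N : ℕ} {g : ℝ → ℝ} {c : ℤ → ℂ} (h : ∀ x, (g x : ℂ) = trigPoly N c x) :
    MemTrig N g := mem_trigSpace_iff.2 ⟨c, funext h⟩

lemma contDiff_trigPoly (N : ℕ) (c : ℤ → ℂ) : ContDiff ℝ (⊤ : ℕ∞) (trigPoly N c) :=
  ContDiff.sum fun k _ => contDiff_const.mul (contDiff_expo k)

lemma trigPoly_periodic (N : ℕ) (c : ℤ → ℂ) : Function.Periodic (trigPoly N c) 1 := by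
  intro x
  simp only [trigPoly, expo_periodic _ x]

lemma MemTrig.contDiff {N : ℕ} {g : ℝ → ℝ} (h : MemTrig N g) : ContDiff ℝ (⊤ : ℕ∞) g := by
  have : g = fun x => (trigPoly N (coeff g) x).re := by
    ext x; rw [← h.eq_trigPoly, Complex.ofReal_re]
  rw [this]
  exact Complex.reCLM.contDiff.comp (contDiff_trigPoly _ _)

lemma MemTrig.periodic {N : ℕ} {g : ℝ → ℝ} (h : MemTrig N g) : Function.Periodic g 1 := by
  intro x
  have := trigPoly_periodic N (coeff g) x
  rw [← h.eq_trigPoly, ← h.eq_trigPoly] at this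
  exact_mod_cast this

lemma memLp_of_continuous {g : ℝ → ℝ} (h : Continuous g) :
    MemLp g 2 (volume.restrict (Ioc (0 : ℝ) 1)) := by
  obtain ⟨C, hC⟩ := isCompact_Icc.exists_bound_of_continuousOn (s := Icc (0 : ℝ) 1) h.continuousOn
  exact MemLp.of_bound h.aestronglyMeasurable C (ae_restrict_of_forall_mem measurableSet_Ioc
    fun x hx => hC x (Ioc_subset_Icc_self hx))

lemma ofReal_re_trigPoly {N : ℕ} {c : ℤ → ℂ} (hc : Hermitian c) (x : ℝ) :
    ((trigPoly N c x).re : ℂ) = trigPoly N c x := by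
  rw [← Complex.conj_eq_iff_re, trigPoly, map_sum]
  refine Finset.sum_nbij' (fun k => -k) (fun k => -k) (fun k hk => neg_mem_box.2 hk)
    (fun k hk => neg_mem_box.2 hk) (by simp) (by simp) fun k _ => ?_
  rw [map_mul, conj_expo, hc k]

lemma ip_trigPoly {g : ℝ → ℝ} (hg : IntervalIntegrable g volume 0 1) (N : ℕ) (c : ℤ → ℂ) :
    ip g (trigPoly N c) = ∑ k ∈ box N, (starRingEnd ℂ) (c k) * coeff g k := by
  simp only [ip, trigPoly, map_sum, map_mul, conj_expo, Finset.mul_sum]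
  rw [intervalIntegral.integral_finsetSum]
  · refine Finset.sum_congr rfl fun k _ => ?_
    rw [coeff_eq_integral, ← intervalIntegral.integral_const_mul]
    congr 1; ext x; ring
  · intro k _
    refine ((IntervalIntegrable.expo_mul hg (-k)).const_mul ((starRingEnd ℂ) (c k))).congr ?_
    exact fun x _ => by ring

/-! ### Sobolev regularity in terms of sequences -/

/-- The square of the `H^μ` norm in terms of Fourier coefficients. -/
def sobSq (μ : ℝ) (a : ℤ → ℂ) : ℝ := ∑' k : ℤ, (1 + (k : ℝ) ^ 2) ^ μ * ‖a k‖ ^ 2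

/-- The sequences with finite `H^μ` norm. -/
def SobSummable (μ : ℝ) (a : ℤ → ℂ) : Prop :=
  Summable fun k : ℤ => (1 + (k : ℝ) ^ 2) ^ μ * ‖a k‖ ^ 2

lemma normH_sq (μ : ℝ) (g : ℝ → ℝ) : normH μ g ^ 2 = sobSq μ (coeff g) :=
  Real.sq_sqrt (tsum_nonneg fun _ => by positivity)

lemma SobSummable.of_le {μ C : ℝ} {a b c d : ℤ → ℂ} (ha : SobSummable μ a) (hb : SobSummable μ b)
    (hc : SobSummable μ c)
    (h : ∀ k, ‖d k‖ ^ 2 ≤ C * (‖a k‖ ^ 2 + ‖b k‖ ^ 2 + ‖c k‖ ^ 2)) :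
    SobSummable μ d ∧ sobSq μ d ≤ C * (sobSq μ a + sobSq μ b + sobSq μ c) := by
  have hs : HasSum (fun k : ℤ => C * ((1 + (k : ℝ) ^ 2) ^ μ * ‖a k‖ ^ 2
      + (1 + (k : ℝ) ^ 2) ^ μ * ‖b k‖ ^ 2 + (1 + (k : ℝ) ^ 2) ^ μ * ‖c k‖ ^ 2))
      (C * (sobSq μ a + sobSq μ b + sobSq μ c)) :=
    ((ha.hasSum.add hb.hasSum).add hc.hasSum).mul_left C
  have hle : ∀ k : ℤ, (1 + (k : ℝ) ^ 2) ^ μ * ‖d k‖ ^ 2 ≤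
      C * ((1 + (k : ℝ) ^ 2) ^ μ * ‖a k‖ ^ 2
      + (1 + (k : ℝ) ^ 2) ^ μ * ‖b k‖ ^ 2 + (1 + (k : ℝ) ^ 2) ^ μ * ‖c k‖ ^ 2) := fun k =>
    (mul_le_mul_of_nonneg_left (h k) (by positivity)).trans (le_of_eq (by ring))
  have hd : SobSummable μ d := Summable.of_nonneg_of_le (fun _ => by positivity) hle hs.summable
  exact ⟨hd, (hd.tsum_le_tsum hle hs.summable).trans hs.tsum_eq.le⟩

lemma norm_sq_add_add_le (x y z : ℂ) : ‖x + y + z‖ ^ 2 ≤ 3 * (‖x‖ ^ 2 + ‖y‖ ^ 2 + ‖z‖ ^ 2) := by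
  have h1 := norm_add₃_le (a := x) (b := y) (c := z)
  have h2 : ‖x + y + z‖ ^ 2 ≤ (‖x‖ + ‖y‖ + ‖z‖) ^ 2 := by gcongr
  nlinarith [sq_nonneg (‖x‖ - ‖y‖), sq_nonneg (‖y‖ - ‖z‖), sq_nonneg (‖x‖ - ‖z‖)]

lemma norm_coeff_le_normH {μ : ℝ} (hμ : 0 ≤ μ) {g : ℝ → ℝ} (h : SobSummable μ (coeff g)) (k : ℤ) :
    ‖coeff g k‖ ≤ normH μ g := by
  refine Real.le_sqrt_of_sq_le (le_trans ?_ (h.le_tsum k fun _ _ => by positivity))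
  exact le_mul_of_one_le_left (sq_nonneg _)
    (Real.one_le_rpow (by nlinarith [sq_nonneg (k : ℝ)]) hμ)

/-- The terms decay like |k|^{-2(μ-1)}, and 2(μ-1) > 1 is exactly μ > 3/2. The indicator of 0 in the
majorant accounts for the term k = 0. -/
lemma summable_weight {μ : ℝ} (hμ : 3 / 2 < μ) :
    Summable fun k : ℤ => (1 + |(k : ℝ)|) ^ 2 * (1 + (k : ℝ) ^ 2) ^ (-μ) := by
  have h1 : Summable fun k : ℤ => 2 * |(k : ℝ)| ^ (-(2 * (μ - 1))) + if k = 0 then (1 : ℝ) else 0 :=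
    ((Real.summable_abs_int_rpow (by linarith)).mul_left 2).add
      (summable_of_ne_finset_zero (s := {0}) fun k hk => by simp at hk; simp [hk])
  refine Summable.of_nonneg_of_le (fun k => by positivity) (fun k => ?_) h1
  rcases eq_or_ne k 0 with rfl | hk
  · simp only [Int.cast_zero, abs_zero, if_true]
    have : 0 ≤ 2 * (0 : ℝ) ^ (-(2 * (μ - 1))) := by positivity
    simpa using this
  · have hk' : 0 < |(k : ℝ)| := abs_pos.2 (by exact_mod_cast hk)
    have hp : (0 : ℝ) < 1 + (k : ℝ) ^ 2 := by positivity
    simp only [hk, if_false, add_zero]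
    calc (1 + |(k : ℝ)|) ^ 2 * (1 + (k : ℝ) ^ 2) ^ (-μ)
        ≤ (2 * (1 + (k : ℝ) ^ 2)) * (1 + (k : ℝ) ^ 2) ^ (-μ) := by
          gcongr
          nlinarith [sq_nonneg (1 - |(k : ℝ)|), sq_abs (k : ℝ)]
      _ = 2 * (1 + (k : ℝ) ^ 2) ^ (1 - μ) := by
          rw [sub_eq_add_neg, Real.rpow_add hp, Real.rpow_one]; ring
      _ ≤ 2 * (|(k : ℝ)| ^ 2) ^ (1 - μ) := by
          refine mul_le_mul_of_nonneg_left ?_ two_pos.le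
          refine Real.rpow_le_rpow_of_nonpos (by positivity) ?_ (by linarith)
          rw [sq_abs]; linarith
      _ = 2 * |(k : ℝ)| ^ (-(2 * (μ - 1))) := by
          rw [← Real.rpow_natCast, ← Real.rpow_mul hk'.le]; congr 2; push_cast; ring

/-- Sobolev embedding. The elementary inequality xy ≤ x² + y², used termwise in place of
Cauchy–Schwarz, gives a sum rather than a product; only a bound uniform in time is wanted. -/
lemma SobSummable.wSummable {μ : ℝ} (hμ : 3 / 2 < μ) {a : ℤ → ℂ} (h : SobSummable μ a) :
    WSummable a ∧
      wnorm a ≤ (∑' k : ℤ, (1 + |(k : ℝ)|) ^ 2 * (1 + (k : ℝ) ^ 2) ^ (-μ)) + sobSq μ a := by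
  have hs := (summable_weight hμ).add h
  have hle : ∀ k : ℤ, (1 + |(k : ℝ)|) * ‖a k‖ ≤
      (1 + |(k : ℝ)|) ^ 2 * (1 + (k : ℝ) ^ 2) ^ (-μ) + (1 + (k : ℝ) ^ 2) ^ μ * ‖a k‖ ^ 2 := by
    intro k
    have hp : (0 : ℝ) < 1 + (k : ℝ) ^ 2 := by positivity
    set r := (1 + (k : ℝ) ^ 2) ^ (μ / 2) with hr
    have hr0 : 0 < r := Real.rpow_pos_of_pos hp _
    have e1 : (1 + (k : ℝ) ^ 2) ^ μ = r ^ 2 := by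
      rw [hr, ← Real.rpow_mul_natCast hp.le]; congr 1; push_cast; ring
    have e2 : (1 + (k : ℝ) ^ 2) ^ (-μ) = (r⁻¹) ^ 2 := by
      rw [Real.rpow_neg hp.le, e1, inv_pow]
    rw [e1, e2]
    have e3 : (1 + |(k : ℝ)|) * ‖a k‖ = ((1 + |(k : ℝ)|) * r⁻¹) * (r * ‖a k‖) := by
      field_simp
    rw [e3]
    have h0 : 0 ≤ ((1 + |(k : ℝ)|) * r⁻¹) * (r * ‖a k‖) := by positivity
    nlinarith [sq_nonneg ((1 + |(k : ℝ)|) * r⁻¹ - r * ‖a k‖)]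
  have hw : WSummable a := Summable.of_nonneg_of_le (fun _ => by positivity) hle hs
  refine ⟨hw, (hw.tsum_le_tsum hle hs).trans ?_⟩
  rw [Summable.tsum_add (summable_weight hμ) h]; rfl

/-- Outside the box |k| ≥ N, so trading μ - 1 derivatives for decay gains N^{1-μ}. The 2 comes from
(1+|k|)² ≤ 2(1+k²). -/
lemma hsq_tail_le {μ : ℝ} (hμ : 1 ≤ μ) {a : ℤ → ℂ} (h : SobSummable μ a) {N : ℕ} (hN : 1 ≤ N) :
    hsq (a - trunc N a) ≤ 2 * sobSq μ a * ((N : ℝ) ^ (1 - μ)) ^ 2 := by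
  have hN0 : (0 : ℝ) < N := by exact_mod_cast hN
  have hle : ∀ k : ℤ, ((1 + |(k : ℝ)|) * ‖(a - trunc N a) k‖) ^ 2 ≤
      2 * ((N : ℝ) ^ (1 - μ)) ^ 2 * ((1 + (k : ℝ) ^ 2) ^ μ * ‖a k‖ ^ 2) := by
    intro k
    by_cases hk : k ∈ box N
    · rw [Pi.sub_apply, trunc_of_mem hk, sub_self, norm_zero, mul_zero, zero_pow two_ne_zero]
      positivity
    · rw [Pi.sub_apply, trunc_of_notMem hk, sub_zero, mul_pow]
      have hNk : (N : ℝ) ≤ |(k : ℝ)| := by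
        have : (N : ℤ) ≤ |k| := by
          rw [mem_box] at hk
          rcases abs_cases k with ⟨h1, h2⟩ | ⟨h1, h2⟩ <;> omega
        exact_mod_cast this
      have hp : (0 : ℝ) < 1 + (k : ℝ) ^ 2 := by positivity
      have h1 : (1 + |(k : ℝ)|) ^ 2 ≤ 2 * ((N : ℝ) ^ (1 - μ)) ^ 2 * (1 + (k : ℝ) ^ 2) ^ μ := by
        calc (1 + |(k : ℝ)|) ^ 2 ≤ 2 * (1 + (k : ℝ) ^ 2) := by
              nlinarith [sq_nonneg (1 - |(k : ℝ)|), sq_abs (k : ℝ)]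
          _ = 2 * (1 + (k : ℝ) ^ 2) ^ (1 - μ) * (1 + (k : ℝ) ^ 2) ^ μ := by
              rw [mul_assoc, ← Real.rpow_add hp]; simp
          _ ≤ 2 * ((N : ℝ) ^ 2) ^ (1 - μ) * (1 + (k : ℝ) ^ 2) ^ μ := by
              refine mul_le_mul_of_nonneg_right (mul_le_mul_of_nonneg_left ?_ two_pos.le)
                (by positivity)
              refine Real.rpow_le_rpow_of_nonpos (by positivity) ?_ (by linarith)
              nlinarith [sq_abs (k : ℝ)]
          _ = _ := by
              rw [← Real.rpow_natCast_mul hN0.le, ← Real.rpow_mul_natCast hN0.le,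
                mul_comm (1 - μ)]
      calc _ ≤ _ := mul_le_mul_of_nonneg_right h1 (sq_nonneg _)
        _ = _ := by ring
  have hs := Summable.mul_left (2 * ((N : ℝ) ^ (1 - μ)) ^ 2) h
  refine ((Summable.of_nonneg_of_le (fun _ => sq_nonneg _) hle hs).tsum_le_tsum hle hs).trans ?_
  rw [tsum_mul_left]
  exact le_of_eq (by rw [sobSq]; ring)

/-! ### The exact solution in Fourier space -/

section Curve

variable {μ T : ℝ} {f f' : ℝ → ℝ → ℝ}

lemma coeff_quotient (hf : IsC1Curve μ T f f') {s t : ℝ} (hs : s ∈ Icc 0 T) (ht : t ∈ Icc 0 T) :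
    coeff (fun x => (s - t)⁻¹ * (f s x - f t x) - f' t x)
      = (((s - t)⁻¹ : ℝ) : ℂ) • (coeff (f s) - coeff (f t)) - coeff (f' t) := by
  have h1 := intervalIntegrable_of_memLp (hf.mem s hs).memLp
  have h2 := intervalIntegrable_of_memLp (hf.mem t ht).memLp
  have h3 := intervalIntegrable_of_memLp (hf.mem_deriv t ht).memLp
  rw [coeff_sub ((h1.sub h2).const_mul _) h3, coeff_const_mul, coeff_sub h1 h2]

/-- `normH` has the default value 0 on non-summable sequences, so a small norm of the quotient says
something about its coefficients only once summability is known. -/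
lemma sobSummable_quotient (hf : IsC1Curve μ T f f') {s t : ℝ} (hs : s ∈ Icc 0 T)
    (ht : t ∈ Icc 0 T) :
    SobSummable μ (coeff (fun x => (s - t)⁻¹ * (f s x - f t x) - f' t x)) := by
  rw [coeff_quotient hf hs ht]
  set c : ℝ := (s - t)⁻¹
  refine (SobSummable.of_le (C := 3 * (c ^ 2 + 1)) (hf.mem s hs).summable (hf.mem t ht).summable
    (hf.mem_deriv t ht).summable fun k => ?_).1
  have h := norm_sq_add_add_le ((c : ℂ) * coeff (f s) k) (-((c : ℂ) * coeff (f t) k))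
    (-coeff (f' t) k)
  have e : ((c : ℂ) • (coeff (f s) - coeff (f t)) - coeff (f' t)) k
      = (c : ℂ) * coeff (f s) k + -((c : ℂ) * coeff (f t) k) + -coeff (f' t) k := by
    simp only [Pi.sub_apply, Pi.smul_apply, smul_eq_mul]; ring
  rw [e]
  refine h.trans ?_
  simp only [norm_neg, norm_mul, Complex.norm_real, Real.norm_eq_abs, mul_pow, sq_abs]
  nlinarith [sq_nonneg ‖coeff (f s) k‖, sq_nonneg ‖coeff (f t) k‖, sq_nonneg ‖coeff (f' t) k‖,
    mul_nonneg (sq_nonneg c) (sq_nonneg ‖coeff (f' t) k‖)]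

lemma IsC1Curve.hasDerivWithinAt_coeff (hμ : 0 ≤ μ) (hf : IsC1Curve μ T f f') {t : ℝ}
    (ht : t ∈ Icc 0 T) (k : ℤ) :
    HasDerivWithinAt (fun s => coeff (f s) k) (coeff (f' t) k) (Icc 0 T) t := by
  rw [hasDerivWithinAt_iff_tendsto_slope, tendsto_iff_norm_sub_tendsto_zero]
  refine squeeze_zero' (Eventually.of_forall fun _ => norm_nonneg _) ?_ (hf.hasDeriv t ht)
  filter_upwards [self_mem_nhdsWithin] with s hs
  refine le_trans (le_of_eq ?_)
    (norm_coeff_le_normH hμ (sobSummable_quotient hf hs.1 ht) k)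
  rw [coeff_quotient hf hs.1 ht]
  simp [slope_def_module]

/-- Near each t the difference quotient minus the derivative, q, has norm below 1, and f(s) = f(t) +
(s-t)q + (s-t)f'(t) bounds f locally; compactness of [0,T] makes the bound global. -/
lemma IsC1Curve.exists_sobSq_le (hf : IsC1Curve μ T f f') :
    ∃ M : ℝ, 0 ≤ M ∧ ∀ t ∈ Icc 0 T, sobSq μ (coeff (f t)) ≤ M := by
  have hnn : ∀ a, 0 ≤ sobSq μ a := fun a => tsum_nonneg fun _ => by positivity
  suffices h : ∃ M : ℝ, ∀ t ∈ Icc 0 T, sobSq μ (coeff (f t)) ≤ M by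
    obtain ⟨M, hM⟩ := h
    exact ⟨max M 0, le_max_right _ _, fun t ht => (hM t ht).trans (le_max_left _ _)⟩
  refine isCompact_Icc.induction_on (p := fun S => ∃ M : ℝ, ∀ t ∈ S, sobSq μ (coeff (f t)) ≤ M)
    ⟨0, by simp⟩ (fun S S' hS ⟨M, hM⟩ => ⟨M, fun t ht => hM t (hS ht)⟩)
    (fun S S' ⟨M, hM⟩ ⟨M', hM'⟩ => ⟨max M M', fun t ht => ht.elim
      (fun h => (hM t h).trans (le_max_left _ _)) fun h => (hM' t h).trans (le_max_right _ _)⟩) ?_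
  intro t ht
  have h1 : ∀ᶠ s in 𝓝[Icc 0 T \ {t}] t,
      normH μ (fun x => (s - t)⁻¹ * (f s x - f t x) - f' t x) < 1 :=
    (hf.hasDeriv t ht).eventually_lt_const one_pos
  have h2 : {s | s ∈ Icc 0 T \ {t} →
      normH μ (fun x => (s - t)⁻¹ * (f s x - f t x) - f' t x) < 1} ∈ 𝓝 t :=
    eventually_nhdsWithin_iff.1 h1
  refine ⟨Icc 0 T ∩ _, inter_mem_nhdsWithin (Icc 0 T) h2,
    3 * (1 + T ^ 2) * (sobSq μ (coeff (f t)) + 1 + sobSq μ (coeff (f' t))), ?_⟩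
  rintro s ⟨hs, hs'⟩
  rcases eq_or_ne s t with rfl | hst
  · have ha := hnn (coeff (f s))
    have hb := hnn (coeff (f' s))
    nlinarith [mul_nonneg (sq_nonneg T) ha, mul_nonneg (sq_nonneg T) hb, sq_nonneg T]
  · have hq := hs' ⟨hs, hst⟩
    set q := fun x => (s - t)⁻¹ * (f s x - f t x) - f' t x with hqdef
    have hq1 : sobSq μ (coeff q) ≤ 1 := by
      rw [← normH_sq]
      have : 0 ≤ normH μ q := Real.sqrt_nonneg _
      nlinarith
    have hqs := sobSummable_quotient hf hs ht
    have hbound := (SobSummable.of_le (C := 3 * (1 + T ^ 2)) (d := coeff (f s))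
      (hf.mem t ht).summable hqs (hf.mem_deriv t ht).summable fun k => ?_).2
    · refine hbound.trans (mul_le_mul_of_nonneg_left ?_ (by positivity))
      linarith
    · have hst' : ((s - t : ℝ) : ℂ) ≠ 0 := by exact_mod_cast sub_ne_zero.2 hst
      have e : coeff (f s) k = coeff (f t) k + ((s - t : ℝ) : ℂ) * coeff q k
          + ((s - t : ℝ) : ℂ) * coeff (f' t) k := by
        rw [hqdef, coeff_quotient hf hs ht]
        simp only [Pi.sub_apply, Pi.smul_apply, smul_eq_mul, Complex.ofReal_inv]
        field_simp
        ring
      have h := norm_sq_add_add_le (coeff (f t) k) (((s - t : ℝ) : ℂ) * coeff q k)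
        (((s - t : ℝ) : ℂ) * coeff (f' t) k)
      rw [← e] at h
      refine h.trans ?_
      simp only [norm_mul, Complex.norm_real, Real.norm_eq_abs, mul_pow, sq_abs]
      have hT : (s - t) ^ 2 ≤ T ^ 2 := by
        exact sq_le_sq' (by linarith [hs.1, ht.2]) (by linarith [hs.2, ht.1])
      nlinarith [mul_le_mul_of_nonneg_right hT (sq_nonneg ‖coeff q k‖),
        mul_le_mul_of_nonneg_right hT (sq_nonneg ‖coeff (f' t) k‖),
        mul_nonneg (sq_nonneg T) (sq_nonneg ‖coeff (f t) k‖), sq_nonneg ‖coeff q k‖,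
        sq_nonneg ‖coeff (f' t) k‖]

end Curve

/-- Testing a conservation law with the real and imaginary parts of `e^{-2πikx}`. -/
lemma symb_mul_coeff_of_weak {f p q : ℝ → ℝ} {c₁ c₂ d : ℝ} (hf : IntervalIntegrable f volume 0 1)
    (hp : IntervalIntegrable p volume 0 1) (hq : IntervalIntegrable q volume 0 1)
    (h : ∀ φ : ℝ → ℝ, ContDiff ℝ (⊤ : ℕ∞) φ → Function.Periodic φ 1 →
      (∫ x in (0 : ℝ)..1, f x * φ x) - c₁ * (∫ x in (0 : ℝ)..1, p x * deriv φ x)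
        - c₂ * (∫ x in (0 : ℝ)..1, q x * deriv φ x)
        - d * (∫ x in (0 : ℝ)..1, f x * iteratedDeriv 2 φ x) = 0) (k : ℤ) :
    (symb d k : ℂ) * coeff f k =
      -(2 * Real.pi * Complex.I * k) * (c₁ * coeff p k + c₂ * coeff q k) := by
  set w : ℝ := 2 * Real.pi * k with hw
  have hcd : ∀ x, HasDerivAt (fun x => Real.cos (w * x)) (-w * Real.sin (w * x)) x := fun x => by
    have := ((hasDerivAt_id x).const_mul w).cos
    simp only [id, mul_one] at this
    exact this.congr_deriv (by ring)
  have hsd : ∀ x, HasDerivAt (fun x => Real.sin (w * x)) (w * Real.cos (w * x)) x := fun x => by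
    have := ((hasDerivAt_id x).const_mul w).sin
    simp only [id, mul_one] at this
    exact this.congr_deriv (by ring)
  have dc : deriv (fun x => Real.cos (w * x)) = fun x => -w * Real.sin (w * x) :=
    funext fun x => (hcd x).deriv
  have ds : deriv (fun x => Real.sin (w * x)) = fun x => w * Real.cos (w * x) :=
    funext fun x => (hsd x).deriv
  have dc2 : iteratedDeriv 2 (fun x => Real.cos (w * x)) = fun x => -w ^ 2 * Real.cos (w * x) := by
    rw [iteratedDeriv_succ, iteratedDeriv_one, dc]
    exact funext fun x => by rw [((hsd x).const_mul (-w)).deriv]; ring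
  have ds2 : iteratedDeriv 2 (fun x => Real.sin (w * x)) = fun x => -w ^ 2 * Real.sin (w * x) := by
    rw [iteratedDeriv_succ, iteratedDeriv_one, ds]
    exact funext fun x => by rw [((hcd x).const_mul w).deriv]; ring
  have pc : Function.Periodic (fun x => Real.cos (w * x)) 1 := fun x => by
    simp only [hw]
    rw [mul_add, mul_one, mul_comm (2 * Real.pi) (k : ℝ), Real.cos_add_int_mul_two_pi]
  have ps : Function.Periodic (fun x => Real.sin (w * x)) 1 := fun x => by
    simp only [hw]
    rw [mul_add, mul_one, mul_comm (2 * Real.pi) (k : ℝ), Real.sin_add_int_mul_two_pi]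
  have h1 := h _ (by fun_prop) pc
  have h2 := h _ (by fun_prop) ps
  rw [dc, dc2] at h1
  rw [ds, ds2] at h2
  have pull : ∀ (g : ℝ → ℝ) (c : ℝ) (r : ℝ → ℝ),
      ∫ x in (0 : ℝ)..1, g x * (c * r x) = c * ∫ x in (0 : ℝ)..1, g x * r x := by
    intro g c r
    rw [← intervalIntegral.integral_const_mul]
    congr 1; ext x; ring
  simp only [pull] at h1 h2
  simp only [hw] at h1 h2
  rw [integral_mul_cos hf, integral_mul_sin hp, integral_mul_sin hq] at h1
  rw [integral_mul_sin hf, integral_mul_cos hp, integral_mul_cos hq] at h2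
  apply Complex.ext
  · simp only [symb, Complex.mul_re, Complex.mul_im, Complex.add_re, Complex.add_im,
      Complex.neg_re, Complex.neg_im, Complex.ofReal_re, Complex.ofReal_im, Complex.I_re,
      Complex.I_im, Complex.intCast_re, Complex.intCast_im, Complex.re_ofNat, Complex.im_ofNat]
    linear_combination h1
  · simp only [symb, Complex.mul_re, Complex.mul_im, Complex.add_re, Complex.add_im,
      Complex.neg_re, Complex.neg_im, Complex.ofReal_re, Complex.ofReal_im, Complex.I_re,
      Complex.I_im, Complex.intCast_re, Complex.intCast_im, Complex.re_ofNat, Complex.im_ofNat]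
    linear_combination -h2

lemma intervalIntegrable_mul_of_memLp {f g : ℝ → ℝ}
    (hf : MemLp f 2 (volume.restrict (Ioc (0 : ℝ) 1)))
    (hg : MemLp g 2 (volume.restrict (Ioc (0 : ℝ) 1))) :
    IntervalIntegrable (fun x => f x * g x) volume 0 1 := by
  rw [intervalIntegrable_iff_integrableOn_Ioc_of_le zero_le_one]
  exact hf.integrable_mul hg

/-- The exact solution: a `C¹` curve of coefficient sequences, bounded in `H^μ`. -/
lemma IsSolution.fourier {γ δ d μ T : ℝ} (hd : 0 < d) (hμ : 0 ≤ μ) {ζ₀ u₀ : ℝ → ℝ}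
    {ζ u : ℝ → ℝ → ℝ} (h : IsSolution γ δ 0 0 0 d μ T ζ₀ u₀ ζ u) :
    (∀ t ∈ Icc 0 T, MemH μ (ζ t) ∧ MemH μ (u t)) ∧
    (∃ M : ℝ, 0 ≤ M ∧ ∀ t ∈ Icc 0 T, sobSq μ (coeff (ζ t)) ≤ M ∧ sobSq μ (coeff (u t)) ≤ M) ∧
    (∀ t ∈ Icc 0 T, ∀ k : ℤ,
      HasDerivWithinAt (fun s => coeff (ζ s) k)
        (rhsZ (kappa1 γ δ) (lam γ δ) (coeff (ζ t)) (coeff (u t)) k) (Icc 0 T) t ∧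
      HasDerivWithinAt (fun s => coeff (u s) k)
        (rhsU (kappa2 γ) (lam γ δ) d (coeff (ζ t)) (coeff (u t)) k) (Icc 0 T) t) ∧
    coeff (ζ 0) = coeff ζ₀ ∧ coeff (u 0) = coeff u₀ := by
  obtain ⟨ζt, ut, hζ, hu, e1, e2, i1, i2⟩ := h
  refine ⟨fun t ht => ⟨hζ.mem t ht, hu.mem t ht⟩, ?_, fun t ht k => ⟨?_, ?_⟩,
    coeff_congr_ae i1, coeff_congr_ae i2⟩
  · obtain ⟨M, hM0, hM⟩ := hζ.exists_sobSq_le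
    obtain ⟨M', -, hM'⟩ := hu.exists_sobSq_le
    exact ⟨max M M', le_max_of_le_left hM0, fun t ht => ⟨(hM t ht).trans (le_max_left _ _),
      (hM' t ht).trans (le_max_right _ _)⟩⟩
  · have hL := (hζ.mem t ht).memLp
    have hL' := (hu.mem t ht).memLp
    -- With d = 0 the symbol is 1, so the same lemma serves the equation without dispersion.
    have := symb_mul_coeff_of_weak (d := 0) (c₁ := kappa1 γ δ) (c₂ := lam γ δ)
      (intervalIntegrable_of_memLp (hζ.mem_deriv t ht).memLp)
      (intervalIntegrable_of_memLp hL') (intervalIntegrable_mul_of_memLp hL hL')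
      (fun φ h1 h2 => by simpa using e1 t ht φ h1 h2) k
    rw [coeff_mul hL hL'] at this
    refine (hζ.hasDerivWithinAt_coeff hμ ht k).congr_deriv ?_
    rw [rhsZ, ← this]
    simp [symb]
  · have hL := (hζ.mem t ht).memLp
    have hL' := (hu.mem t ht).memLp
    have := symb_mul_coeff_of_weak (d := d) (c₁ := kappa2 γ) (c₂ := lam γ δ)
      (p := ζ t) (q := fun x => (1 / 2) * (u t x * u t x))
      (intervalIntegrable_of_memLp (hu.mem_deriv t ht).memLp)
      (intervalIntegrable_of_memLp hL) ((intervalIntegrable_mul_of_memLp hL' hL').const_mul _)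
      (fun φ h1 h2 => by
        have e : ∀ x, u t x ^ 2 / 2 = (1 / 2) * (u t x * u t x) := fun x => by ring
        simpa only [mul_zero, zero_mul, sub_zero, e] using e2 t ht φ h1 h2) k
    rw [coeff_const_mul, coeff_mul hL' hL'] at this
    refine (hu.hasDerivWithinAt_coeff hμ ht k).congr_deriv ?_
    have hs : (symb d k : ℂ) ≠ 0 := by exact_mod_cast (symb_pos hd k).ne'
    rw [rhsU, eq_div_iff hs, mul_comm, this]
    simp only [Pi.smul_apply, smul_eq_mul]
    push_cast; ring

/-! ### The Galerkin problem in Fourier space -/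

/-- The system of ordinary differential equations for the Fourier coefficients of the Galerkin
approximation. -/
structure IsCoeffGalerkin (κ₁ κ₂ l d T : ℝ) (N : ℕ) (a₀ b₀ : ℤ → ℂ) (a b : ℝ → ℤ → ℂ) :
    Prop where
  hermitian : ∀ t ∈ Icc (0 : ℝ) T, Hermitian (a t) ∧ Hermitian (b t)
  support : ∀ t ∈ Icc (0 : ℝ) T, (∀ k ∉ box N, a t k = 0) ∧ ∀ k ∉ box N, b t k = 0
  deriv : ∀ t ∈ Icc (0 : ℝ) T, ∀ k ∈ box N,
    HasDerivWithinAt (fun s => a s k) (rhsZ κ₁ l (a t) (b t) k) (Icc 0 T) t ∧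
    HasDerivWithinAt (fun s => b s k) (rhsU κ₂ l d (a t) (b t) k) (Icc 0 T) t
  init : a 0 = trunc N a₀ ∧ b 0 = trunc N b₀

lemma conv_hermitian {a b : ℤ → ℂ} (ha : Hermitian a) (hb : Hermitian b) :
    Hermitian (conv a b) := by
  intro k
  rw [conv, conv, Complex.conj_tsum, ← (Equiv.neg ℤ).tsum_eq]
  refine tsum_congr fun m => ?_
  rw [map_mul, ← ha, ← hb, Equiv.neg_apply]
  congr 2; ring

lemma rhsZ_hermitian (κ l : ℝ) {a b : ℤ → ℂ} (ha : Hermitian a) (hb : Hermitian b) :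
    Hermitian (rhsZ κ l a b) := by
  intro k
  simp only [rhsZ, conv_hermitian ha hb k, hb k, map_mul, map_add, map_neg, Complex.conj_I,
    Complex.conj_ofReal, map_intCast, Int.cast_neg, Complex.conj_ofNat]
  ring

lemma rhsU_hermitian (κ l d : ℝ) {a b : ℤ → ℂ} (ha : Hermitian a) (hb : Hermitian b) :
    Hermitian (rhsU κ l d a b) := by
  intro k
  have hs : symb d (-k) = symb d k := by simp [symb]
  simp only [rhsU, hs, conv_hermitian hb hb k, ha k, map_mul, map_add, map_neg, map_div₀,
    Complex.conj_I, Complex.conj_ofReal, map_intCast, Int.cast_neg, Complex.conj_ofNat]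
  ring

lemma expo_mem_trigSpace {N : ℕ} {k : ℤ} (hk : k ∈ box N) : expo k ∈ trigSpace N :=
  Submodule.subset_span ⟨k, mem_box.1 hk, rfl⟩

lemma contDiff_deriv_of_memTrig {N : ℕ} {g : ℝ → ℝ} (h : MemTrig N g) :
    ContDiff ℝ 1 (deriv g) :=
  (contDiff_succ_iff_deriv.1 (h.contDiff.of_le (m := 1 + 1) (by norm_cast))).2.2

lemma MemTrig.contDiff_one {N : ℕ} {g : ℝ → ℝ} (h : MemTrig N g) : ContDiff ℝ 1 g :=
  h.contDiff.of_le (by norm_cast)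

lemma periodic_deriv {g : ℝ → ℝ} (h : Function.Periodic g 1) : Function.Periodic (deriv g) 1 := by
  intro x
  rw [← deriv_comp_add_const]
  congr 1
  exact funext h

lemma galerkin_fst_iff {N : ℕ} {κ l : ℝ} {zt z w : ℝ → ℝ} (hzt : MemTrig N zt) (hz : MemTrig N z)
    (hw : MemTrig N w) :
    (∀ φ ∈ trigSpace N, ip zt φ + (κ : ℂ) * ip (deriv w) φ
        + (l : ℂ) * ip (deriv (fun x => z x * w x)) φ
        + ((0 : ℝ) : ℂ) * ip (iteratedDeriv 3 w) φ
        - ((0 : ℝ) : ℂ) * ip (iteratedDeriv 2 zt) φ = 0) ↔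
      ∀ k ∈ box N, coeff zt k = rhsZ κ l (coeff z) (coeff w) k := by
  have hzw : ContDiff ℝ 1 (fun x => z x * w x) := hz.contDiff_one.mul hw.contDiff_one
  have e1 := coeff_deriv hw.contDiff_one hw.periodic
  have e2 := coeff_deriv hzw (hz.periodic.mul hw.periodic)
  rw [coeff_mul (memLp_of_continuous hz.contDiff_one.continuous)
    (memLp_of_continuous hw.contDiff_one.continuous)] at e2
  simp only [Complex.ofReal_zero, zero_mul, add_zero, sub_zero]
  constructor
  · intro h k hk
    have := h _ (expo_mem_trigSpace hk)
    rw [ip_expo, ip_expo, ip_expo, e1, e2] at this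
    rw [rhsZ]
    linear_combination this
  · intro h φ hφ
    obtain ⟨c, rfl⟩ := mem_trigSpace_iff.1 hφ
    rw [ip_trigPoly (hzt.contDiff_one.continuous.intervalIntegrable _ _),
      ip_trigPoly ((hw.contDiff_one.continuous_deriv le_rfl).intervalIntegrable _ _),
      ip_trigPoly ((hzw.continuous_deriv le_rfl).intervalIntegrable _ _),
      Finset.mul_sum, Finset.mul_sum, ← Finset.sum_add_distrib, ← Finset.sum_add_distrib]
    refine Finset.sum_eq_zero fun k hk => ?_
    rw [e1, e2, h k hk, rhsZ]
    ring

lemma galerkin_snd_iff {N : ℕ} {κ l d γ : ℝ} (hd : 0 < d) {wt z w : ℝ → ℝ} (hwt : MemTrig N wt)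
    (hz : MemTrig N z) (hw : MemTrig N w) :
    (∀ φ ∈ trigSpace N, ip wt φ + (κ : ℂ) * ip (deriv z) φ
        + (l : ℂ) * ip (fun x => w x * deriv w x) φ
        + ((1 - γ) * (0 : ℝ) : ℂ) * ip (iteratedDeriv 3 z) φ
        - (d : ℂ) * ip (iteratedDeriv 2 wt) φ = 0) ↔
      ∀ k ∈ box N, coeff wt k = rhsU κ l d (coeff z) (coeff w) k := by
  have hww : ContDiff ℝ 1 (fun x => (1 / 2) * (w x * w x)) :=
    contDiff_const.mul (hw.contDiff_one.mul hw.contDiff_one)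
  have e0 : (fun x => w x * deriv w x) = deriv (fun x => (1 / 2) * (w x * w x)) := by
    ext x
    have := hw.contDiff_one.differentiable one_ne_zero x |>.hasDerivAt
    rw [((this.fun_mul this).const_mul (1 / 2 : ℝ)).deriv]; ring
  have e1 := coeff_deriv hz.contDiff_one hz.periodic
  have e2 := coeff_deriv hww (fun x => by simp only [hw.periodic x])
  have hL := memLp_of_continuous hw.contDiff_one.continuous
  rw [coeff_const_mul, coeff_mul hL hL] at e2
  have e3 : ∀ k, coeff (iteratedDeriv 2 wt) k
      = 2 * Real.pi * Complex.I * k * (2 * Real.pi * Complex.I * k * coeff wt k) := fun k => by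
    rw [iteratedDeriv_succ, iteratedDeriv_one,
      coeff_deriv (contDiff_deriv_of_memTrig hwt) (periodic_deriv hwt.periodic),
      coeff_deriv hwt.contDiff_one hwt.periodic]
  have hc3 : Continuous (iteratedDeriv 2 wt) := by
    rw [iteratedDeriv_succ, iteratedDeriv_one]
    exact (contDiff_deriv_of_memTrig hwt).continuous_deriv le_rfl
  have hI := Complex.I_sq
  simp only [Complex.ofReal_zero, mul_zero, zero_mul, add_zero, e0]
  -- Clearing the denominator `symb` turns the Fourier form into the tested equation; the I² of the
  -- two derivatives accounts for the sign of 4π²dk².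
  have key : ∀ k, coeff wt k = rhsU κ l d (coeff z) (coeff w) k ↔
      coeff wt k + κ * coeff (deriv z) k + l * coeff (deriv fun x => (1 / 2) * (w x * w x)) k
        - d * coeff (iteratedDeriv 2 wt) k = 0 := by
    intro k
    have hs : (symb d k : ℂ) ≠ 0 := by exact_mod_cast (symb_pos hd k).ne'
    rw [rhsU, eq_div_iff hs, e1, e2, e3]
    simp only [symb, Pi.smul_apply, smul_eq_mul]
    push_cast
    constructor
    · intro h
      linear_combination h - 4 * d * Real.pi ^ 2 * k ^ 2 * coeff wt k * hI
    · intro h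
      linear_combination h + 4 * d * Real.pi ^ 2 * k ^ 2 * coeff wt k * hI
  simp only [key]
  constructor
  · intro h k hk
    have := h _ (expo_mem_trigSpace hk)
    rwa [ip_expo, ip_expo, ip_expo, ip_expo] at this
  · intro h φ hφ
    obtain ⟨c, rfl⟩ := mem_trigSpace_iff.1 hφ
    rw [ip_trigPoly (hwt.contDiff_one.continuous.intervalIntegrable _ _),
      ip_trigPoly ((hz.contDiff_one.continuous_deriv le_rfl).intervalIntegrable _ _),
      ip_trigPoly ((hww.continuous_deriv le_rfl).intervalIntegrable _ _),
      ip_trigPoly (hc3.intervalIntegrable _ _),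
      Finset.mul_sum, Finset.mul_sum, Finset.mul_sum, ← Finset.sum_add_distrib,
      ← Finset.sum_add_distrib, ← Finset.sum_sub_distrib]
    refine Finset.sum_eq_zero fun k hk => ?_
    linear_combination (starRingEnd ℂ) (c k) * h k hk

/-! #### Trigonometric interpolation -/

/-- A geometric sum of powers of a root of unity of order 2N+1. The bound on n ensures that n = 0 is
the only multiple of 2N+1 allowed. -/
lemma sum_expo_nodes {N : ℕ} {n : ℤ} (hn : |n| ≤ 2 * N) :
    ∑ j ∈ Finset.range (2 * N + 1), expo n ((j : ℝ) / (2 * N + 1 : ℕ))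
      = if n = 0 then ((2 * N + 1 : ℕ) : ℂ) else 0 := by
  split_ifs with h0
  · subst h0; simp [expo_zero]
  · have hM : (2 * N + 1 : ℕ) ≠ 0 := by omega
    have hω := Complex.isPrimitiveRoot_exp (2 * N + 1) hM
    set ω := Complex.exp (2 * Real.pi * Complex.I / ((2 * N + 1 : ℕ) : ℂ)) with hωd
    have h1 : ∀ j : ℕ, expo n ((j : ℝ) / (2 * N + 1 : ℕ)) = (ω ^ n) ^ j := by
      intro j
      rw [hωd, ← Complex.exp_int_mul, ← Complex.exp_nat_mul, expo]
      congr 1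
      push_cast
      ring
    have h2 : ω ^ n ≠ 1 := by
      rw [Ne, hω.zpow_eq_one_iff_dvd]
      intro hd
      have := Int.le_of_dvd (abs_pos.2 h0) ((dvd_abs _ _).2 hd)
      push_cast at this
      omega
    have h3 : (ω ^ n) ^ (2 * N + 1) = 1 := by
      rw [← zpow_natCast, zpow_comm, zpow_natCast, hω.pow_eq_one, one_zpow]
    simp only [h1]
    rw [geom_sum_eq h2, h3, sub_self, zero_div]

/-- The equispaced rule with 2N+1 nodes is exact for frequencies up to 2N in modulus. Coefficients
thus become finite combinations of point values, and differentiability in time at each x passes to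
them. -/
lemma coeff_eq_sum_nodes {N : ℕ} {g : ℝ → ℝ} (hg : MemTrig N g) {k : ℤ} (hk : k ∈ box N) :
    coeff g k = ((2 * N + 1 : ℕ) : ℂ)⁻¹ * ∑ j ∈ Finset.range (2 * N + 1),
      expo (-k) ((j : ℝ) / (2 * N + 1 : ℕ)) * (g ((j : ℝ) / (2 * N + 1 : ℕ)) : ℂ) := by
  have hM : ((2 * N + 1 : ℕ) : ℂ) ≠ 0 := by exact_mod_cast (by omega : 2 * N + 1 ≠ 0)
  simp only [hg.eq_trigPoly, trigPoly, Finset.mul_sum]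
  rw [Finset.sum_comm]
  have : ∀ m ∈ box N, ∑ j ∈ Finset.range (2 * N + 1), ((2 * N + 1 : ℕ) : ℂ)⁻¹ *
      (expo (-k) ((j : ℝ) / (2 * N + 1 : ℕ)) * (coeff g m * expo m ((j : ℝ) / (2 * N + 1 : ℕ))))
      = if m = k then coeff g m else 0 := by
    intro m hm
    have hmk : |m - k| ≤ 2 * N := by
      rw [mem_box] at hm hk
      rw [abs_le]; omega
    have h := sum_expo_nodes hmk
    simp only [sub_eq_zero] at h
    have e : ∀ j : ℕ, ((2 * N + 1 : ℕ) : ℂ)⁻¹ *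
        (expo (-k) ((j : ℝ) / (2 * N + 1 : ℕ)) * (coeff g m * expo m ((j : ℝ) / (2 * N + 1 : ℕ))))
        = ((2 * N + 1 : ℕ) : ℂ)⁻¹ * coeff g m * expo (m - k) ((j : ℝ) / (2 * N + 1 : ℕ)) := by
      intro j
      rw [sub_eq_add_neg, expo_add]; ring
    simp only [e]
    rw [← Finset.mul_sum, h]
    split_ifs
    · field_simp
    · simp
  rw [Finset.sum_congr rfl this]
  simp [hk]

/-- Pointwise differentiability in time gives differentiability of the coefficients. -/
lemma hasDerivWithinAt_coeff_of_pointwise {T : ℝ} (hT : 0 < T) {N : ℕ} {f f' : ℝ → ℝ → ℝ}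
    (hf : ∀ t ∈ Icc (0 : ℝ) T, MemTrig N (f t))
    (hf' : ∀ t ∈ Icc (0 : ℝ) T, ∀ x, HasDerivWithinAt (fun s => f s x) (f' t x) (Icc 0 T) t)
    {t : ℝ} (ht : t ∈ Icc 0 T) :
    MemTrig N (f' t) ∧ ∀ k ∈ box N,
      HasDerivWithinAt (fun s => coeff (f s) k) (coeff (f' t) k) (Icc 0 T) t := by
  set c : ℤ → ℂ := fun k => ((2 * N + 1 : ℕ) : ℂ)⁻¹ * ∑ j ∈ Finset.range (2 * N + 1),
      expo (-k) ((j : ℝ) / (2 * N + 1 : ℕ)) * (f' t ((j : ℝ) / (2 * N + 1 : ℕ)) : ℂ) with hc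
  have h1 : ∀ k ∈ box N, HasDerivWithinAt (fun s => coeff (f s) k) (c k) (Icc 0 T) t := by
    intro k hk
    refine HasDerivWithinAt.congr (f := fun s => ((2 * N + 1 : ℕ) : ℂ)⁻¹ *
      ∑ j ∈ Finset.range (2 * N + 1), expo (-k) ((j : ℝ) / (2 * N + 1 : ℕ)) *
        (f s ((j : ℝ) / (2 * N + 1 : ℕ)) : ℂ)) ?_
      (fun s hs => coeff_eq_sum_nodes (hf s hs) hk) (coeff_eq_sum_nodes (hf t ht) hk)
    refine HasDerivWithinAt.const_mul _ (HasDerivWithinAt.fun_sum fun j _ => ?_)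
    exact HasDerivWithinAt.const_mul _ (hf' t ht _).ofReal_comp
  -- That the time derivative is again a trigonometric polynomial follows from uniqueness of
  -- derivatives within [0,T], available because T > 0.
  have h2 : ∀ x, (f' t x : ℂ) = trigPoly N c x := by
    intro x
    have d1 : HasDerivWithinAt (fun s => (f s x : ℂ)) (f' t x : ℂ) (Icc 0 T) t :=
      (hf' t ht x).ofReal_comp
    have d2 : HasDerivWithinAt (fun s => (f s x : ℂ)) (trigPoly N c x) (Icc 0 T) t := by
      refine HasDerivWithinAt.congr (f := fun s => trigPoly N (coeff (f s)) x) ?_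
        (fun s hs => (hf s hs).eq_trigPoly x) ((hf t ht).eq_trigPoly x)
      exact HasDerivWithinAt.fun_sum fun k hk => (h1 k hk).mul_const _
    exact (uniqueDiffOn_Icc hT t ht).eq_deriv _ d1 d2
  refine ⟨MemTrig.of_trigPoly h2, fun k hk => ?_⟩
  rw [coeff_of_eq_trigPoly h2, trunc_of_mem hk]
  exact h1 k hk

lemma IsGalerkin.coeff {γ δ d T : ℝ} (hd : 0 < d) (hT : 0 < T) {N : ℕ} {ζ₀ u₀ : ℝ → ℝ}
    {ζN uN : ℝ → ℝ → ℝ} (h : IsGalerkin γ δ 0 0 0 d T N ζ₀ u₀ ζN uN) :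
    IsCoeffGalerkin (kappa1 γ δ) (kappa2 γ) (lam γ δ) d T N (coeff ζ₀) (coeff u₀)
      (fun t => coeff (ζN t)) (fun t => coeff (uN t)) := by
  obtain ⟨hmem, ⟨ζNt, uNt, hder, e1, e2⟩, h0⟩ := h
  have hm1 : ∀ t ∈ Icc (0 : ℝ) T, MemTrig N (ζN t) := fun t ht => (hmem t ht).1
  have hm2 : ∀ t ∈ Icc (0 : ℝ) T, MemTrig N (uN t) := fun t ht => (hmem t ht).2
  refine ⟨fun t _ => ⟨coeff_hermitian _, coeff_hermitian _⟩,
    fun t ht => ⟨(hm1 t ht).coeff_eq_zero, (hm2 t ht).coeff_eq_zero⟩, fun t ht k hk => ?_, ?_⟩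
  · obtain ⟨z1, z2⟩ := hasDerivWithinAt_coeff_of_pointwise hT hm1 (fun t ht x => (hder t ht x).1) ht
    obtain ⟨w1, w2⟩ := hasDerivWithinAt_coeff_of_pointwise hT hm2 (fun t ht x => (hder t ht x).2) ht
    refine ⟨(z2 k hk).congr_deriv ?_, (w2 k hk).congr_deriv ?_⟩
    · exact (galerkin_fst_iff z1 (hm1 t ht) (hm2 t ht)).1 (e1 t ht) k hk
    · exact (galerkin_snd_iff hd w1 (hm1 t ht) (hm2 t ht)).1 (e2 t ht) k hk
  · exact ⟨coeff_of_eq_trigPoly fun x => (h0 x).1, coeff_of_eq_trigPoly fun x => (h0 x).2⟩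

lemma trunc_eq_self {N : ℕ} {a : ℤ → ℂ} (h : ∀ k ∉ box N, a k = 0) : trunc N a = a := by
  ext k
  by_cases hk : k ∈ box N
  · exact trunc_of_mem hk
  · rw [trunc_of_notMem hk, h k hk]

lemma IsCoeffGalerkin.isGalerkin {γ δ d T : ℝ} (hd : 0 < d) (hT : 0 < T) {N : ℕ} {ζ₀ u₀ : ℝ → ℝ}
    {a b : ℝ → ℤ → ℂ}
    (h : IsCoeffGalerkin (kappa1 γ δ) (kappa2 γ) (lam γ δ) d T N (coeff ζ₀) (coeff u₀) a b) :
    IsGalerkin γ δ 0 0 0 d T N ζ₀ u₀ (fun t x => (trigPoly N (a t) x).re)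
      (fun t x => (trigPoly N (b t) x).re) := by
  set Z : ℝ → ℤ → ℂ := fun t => rhsZ (kappa1 γ δ) (lam γ δ) (a t) (b t)
  set W : ℝ → ℤ → ℂ := fun t => rhsU (kappa2 γ) (lam γ δ) d (a t) (b t)
  have ha : ∀ t ∈ Icc (0 : ℝ) T, ∀ x, ((trigPoly N (a t) x).re : ℂ) = trigPoly N (a t) x :=
    fun t ht => ofReal_re_trigPoly (h.hermitian t ht).1
  have hb : ∀ t ∈ Icc (0 : ℝ) T, ∀ x, ((trigPoly N (b t) x).re : ℂ) = trigPoly N (b t) x :=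
    fun t ht => ofReal_re_trigPoly (h.hermitian t ht).2
  have hZ : ∀ t ∈ Icc (0 : ℝ) T, ∀ x, ((trigPoly N (Z t) x).re : ℂ) = trigPoly N (Z t) x :=
    fun t ht => ofReal_re_trigPoly (rhsZ_hermitian _ _ (h.hermitian t ht).1 (h.hermitian t ht).2)
  have hW : ∀ t ∈ Icc (0 : ℝ) T, ∀ x, ((trigPoly N (W t) x).re : ℂ) = trigPoly N (W t) x :=
    fun t ht => ofReal_re_trigPoly (rhsU_hermitian _ _ _ (h.hermitian t ht).1 (h.hermitian t ht).2)
  have ca : ∀ t ∈ Icc (0 : ℝ) T, Boussinesq.coeff (fun x => (trigPoly N (a t) x).re) = a t :=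
    fun t ht => by rw [coeff_of_eq_trigPoly (ha t ht), trunc_eq_self (h.support t ht).1]
  have cb : ∀ t ∈ Icc (0 : ℝ) T, Boussinesq.coeff (fun x => (trigPoly N (b t) x).re) = b t :=
    fun t ht => by rw [coeff_of_eq_trigPoly (hb t ht), trunc_eq_self (h.support t ht).2]
  have h0 : (0 : ℝ) ∈ Icc (0 : ℝ) T := ⟨le_rfl, hT.le⟩
  refine ⟨fun t ht => ⟨MemTrig.of_trigPoly (ha t ht), MemTrig.of_trigPoly (hb t ht)⟩,
    ⟨fun t x => (trigPoly N (Z t) x).re, fun t x => (trigPoly N (W t) x).re, ?_, ?_, ?_⟩, ?_⟩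
  · intro t ht x
    constructor
    · exact Complex.reCLM.hasFDerivAt.comp_hasDerivWithinAt t
        (HasDerivWithinAt.fun_sum fun k hk => ((h.deriv t ht k hk).1.mul_const (expo k x)))
    · exact Complex.reCLM.hasFDerivAt.comp_hasDerivWithinAt t
        (HasDerivWithinAt.fun_sum fun k hk => ((h.deriv t ht k hk).2.mul_const (expo k x)))
  · intro t ht
    refine (galerkin_fst_iff (MemTrig.of_trigPoly (hZ t ht)) (MemTrig.of_trigPoly (ha t ht))
      (MemTrig.of_trigPoly (hb t ht))).2 fun k hk => ?_
    rw [ca t ht, cb t ht, coeff_of_eq_trigPoly (hZ t ht), trunc_of_mem hk]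
  · intro t ht
    refine (galerkin_snd_iff hd (MemTrig.of_trigPoly (hW t ht)) (MemTrig.of_trigPoly (ha t ht))
      (MemTrig.of_trigPoly (hb t ht))).2 fun k hk => ?_
    rw [ca t ht, cb t ht, coeff_of_eq_trigPoly (hW t ht), trunc_of_mem hk]
  · intro x
    rw [ha 0 h0, hb 0 h0, h.init.1, h.init.2, proj_eq_trigPoly, proj_eq_trigPoly, trigPoly_trunc,
      trigPoly_trunc]
    exact ⟨rfl, rfl⟩

/-! ### Ordinary differential equations -/

lemma hasDerivWithinAt_Ici_of_Icc {E : Type*} [NormedAddCommGroup E] [NormedSpace ℝ E]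
    {y : ℝ → E} {y' : E} {T t : ℝ} (h : HasDerivWithinAt y y' (Icc 0 T) t) (ht : t ∈ Ico 0 T) :
    HasDerivWithinAt y y' (Ici t) t :=
  h.mono_of_mem_nhdsWithin (Icc_mem_nhdsGE_of_mem ht)

/-- Global existence for `y' = f (p + z (y - p))` when `z` has compact support. -/
lemma exists_solution_of_cutoff {E : Type*} [NormedAddCommGroup E] [NormedSpace ℝ E]
    [FiniteDimensional ℝ E] {f z : E → E} (hf : ContDiff ℝ 1 f) (hz : ContDiff ℝ 1 z)
    (hzc : HasCompactSupport z) {T : ℝ} (hT : 0 < T) {p : ℝ → E}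
    (hp : ContinuousOn p (Icc 0 T)) :
    ∃ y : ℝ → E, y 0 = p 0 ∧
      ∀ t ∈ Icc 0 T, HasDerivWithinAt y (f (p t + z (y t - p t))) (Icc 0 T) t := by
  have : CompleteSpace E := FiniteDimensional.complete ℝ E
  have : ProperSpace E := FiniteDimensional.proper ℝ E
  obtain ⟨Cz, hCz⟩ := hzc.exists_bound_of_continuous hz.continuous
  obtain ⟨Cp, hCp⟩ := isCompact_Icc.exists_bound_of_continuousOn hp
  obtain ⟨Kz, hKz⟩ := ContDiff.lipschitzWith_of_hasCompactSupport hzc hz one_ne_zero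
  -- The argument p + z(·) of f never leaves this ball, so a Lipschitz constant and a bound for f
  -- there make the modified field globally Lipschitz and bounded.
  set R := Cp + Cz
  have hK : IsCompact (Metric.closedBall (0 : E) R) := isCompact_closedBall _ _
  obtain ⟨Kf, hKf⟩ := hf.contDiffOn.exists_lipschitzOnWith one_ne_zero
    (convex_closedBall (0 : E) R) hK
  obtain ⟨L, hL⟩ := hK.exists_bound_of_continuousOn hf.continuous.continuousOn
  have hmem : ∀ t ∈ Icc 0 T, ∀ w, p t + z w ∈ Metric.closedBall (0 : E) R := fun t ht w => by
    rw [mem_closedBall_zero_iff]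
    exact (norm_add_le _ _).trans (add_le_add (hCp t ht) (hCz w))
  -- The ball around p 0 has radius at least LT, the farthest a solution with speed at most L can
  -- travel, so one application covers the whole interval.
  have hPL : IsPicardLindelof (fun t y => f (p t + z (y - p t)))
      (⟨0, le_rfl, hT.le⟩ : Icc (0 : ℝ) T) (p 0) (L.toNNReal * T.toNNReal) 0 L.toNNReal
      (Kf * Kz) := by
    refine ⟨fun t ht => ?_, fun y _ => ?_, fun t ht y _ => ?_, ?_⟩
    · refine LipschitzOnWith.comp (t := Metric.closedBall (0 : E) R) hKf ?_ fun y _ => hmem t ht _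
      refine LipschitzWith.lipschitzOnWith (LipschitzWith.of_dist_le_mul fun y y' => ?_)
      have := hKz.dist_le_mul (y - p t) (y' - p t)
      simpa using this
    · exact hf.continuous.comp_continuousOn
        (hp.add (hz.continuous.comp_continuousOn (continuousOn_const.sub hp)))
    · exact (hL _ (hmem t ht _)).trans (Real.le_coe_toNNReal L)
    · simp [hT.le]
  exact hPL.exists_eq_forall_mem_Icc_hasDerivWithinAt₀

lemma eqOn_of_hasDerivWithinAt {E : Type*} [NormedAddCommGroup E] [NormedSpace ℝ E]
    [FiniteDimensional ℝ E] {f : E → E} (hf : ContDiff ℝ 1 f) {T : ℝ} {x y : ℝ → E}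
    (hx : ∀ t ∈ Icc 0 T, HasDerivWithinAt x (f (x t)) (Icc 0 T) t)
    (hy : ∀ t ∈ Icc 0 T, HasDerivWithinAt y (f (y t)) (Icc 0 T) t) (h0 : x 0 = y 0) :
    EqOn x y (Icc 0 T) := by
  have : ProperSpace E := FiniteDimensional.proper ℝ E
  have hxc : ContinuousOn x (Icc 0 T) := fun t ht => (hx t ht).continuousWithinAt
  have hyc : ContinuousOn y (Icc 0 T) := fun t ht => (hy t ht).continuousWithinAt
  obtain ⟨Cx, hCx⟩ := isCompact_Icc.exists_bound_of_continuousOn hxc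
  obtain ⟨Cy, hCy⟩ := isCompact_Icc.exists_bound_of_continuousOn hyc
  set R := max Cx Cy
  obtain ⟨K, hK⟩ := hf.contDiffOn.exists_lipschitzOnWith one_ne_zero
    (convex_closedBall (0 : E) R) (isCompact_closedBall _ _)
  exact ODE_solution_unique_of_mem_Icc_right (v := fun _ => f)
    (s := fun _ => Metric.closedBall (0 : E) R) (fun _ _ => hK) hxc
    (fun t ht => hasDerivWithinAt_Ici_of_Icc (hx t (Ico_subset_Icc_self ht)) ht)
    (fun t ht => mem_closedBall_zero_iff.2
      ((hCx t (Ico_subset_Icc_self ht)).trans (le_max_left _ _))) hyc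
    (fun t ht => hasDerivWithinAt_Ici_of_Icc (hy t (Ico_subset_Icc_self ht)) ht)
    (fun t ht => mem_closedBall_zero_iff.2
      ((hCy t (Ico_subset_Icc_self ht)).trans (le_max_right _ _))) h0

/-- Grönwall's inequality for `E' ≤ 2 K (E + τ √E)`. -/
lemma le_exp_mul_sq_of_deriv_le {T K τ : ℝ} (hK : 0 < K) {E E' : ℝ → ℝ}
    (hE : ∀ t ∈ Icc 0 T, HasDerivWithinAt E (E' t) (Icc 0 T) t) (h0 : E 0 = 0)
    (hnn : ∀ t ∈ Icc 0 T, 0 ≤ E t)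
    (hle : ∀ t ∈ Icc 0 T, E' t ≤ 2 * (K * (E t + τ * √(E t)))) :
    ∀ t ∈ Icc 0 T, E t ≤ Real.exp (3 * K * T) * τ ^ 2 := by
  intro t ht
  -- From 2τ√E ≤ τ² + E the hypothesis becomes E' ≤ 3KE + Kτ².
  have h := le_gronwallBound_of_liminf_deriv_right_le (δ := 0) (K := 3 * K) (ε := K * τ ^ 2)
    (f := E) (f' := E') (a := 0) (b := T) (fun t ht => (hE t ht).continuousWithinAt)
    (fun x hx r hr => by
      simpa [slope_def_field, div_eq_inv_mul] using
        (hasDerivWithinAt_Ici_of_Icc (hE x (Ico_subset_Icc_self hx)) hx).liminf_right_slope_le hr)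
    h0.le (fun x hx => by
      have h1 := hle x (Ico_subset_Icc_self hx)
      have h2 := Real.sq_sqrt (hnn x (Ico_subset_Icc_self hx))
      nlinarith [mul_nonneg hK.le (sq_nonneg (τ - √(E x)))]) t ht
  rw [gronwallBound_of_K_ne_0 (by positivity)] at h
  refine h.trans ?_
  have h3 : Real.exp (3 * K * (t - 0)) ≤ Real.exp (3 * K * T) := by
    refine Real.exp_le_exp.2 (mul_le_mul_of_nonneg_left ?_ (by positivity))
    linarith [ht.2]
  have h4 : K * τ ^ 2 / (3 * K) = τ ^ 2 / 3 := by field_simp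
  have h5 := Real.exp_pos (3 * K * (t - 0))
  rw [h4]
  nlinarith [sq_nonneg τ, mul_le_mul_of_nonneg_left h3 (sq_nonneg τ),
    mul_nonneg (sq_nonneg τ) h5.le]

/-! ### Real coordinates for Hermitian sequences -/

/-- The extension by zero of a function on `box N`. -/
def extend {N : ℕ} (y : box N → ℝ) (k : ℤ) : ℝ := if h : k ∈ box N then y ⟨k, h⟩ else 0

/-- The Hermitian sequence with real coordinates `y`: the Fourier coefficients of
`∑ y k (cos 2πkx + sin 2πkx)`. -/
def herm {N : ℕ} (y : box N → ℝ) (k : ℤ) : ℂ :=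
  (((extend y k + extend y (-k)) / 2 : ℝ) : ℂ) +
    (((extend y k - extend y (-k)) / 2 : ℝ) : ℂ) * Complex.I

/-- The real coordinates of a Hermitian sequence. -/
def coords (N : ℕ) (a : ℤ → ℂ) (k : box N) : ℝ := (a k).re + (a k).im

lemma herm_hermitian {N : ℕ} (y : box N → ℝ) : Hermitian (herm y) := by
  intro k
  simp only [herm, neg_neg, map_add, map_mul, Complex.conj_ofReal, Complex.conj_I]
  push_cast; ring

lemma herm_support {N : ℕ} (y : box N → ℝ) : ∀ k ∉ box N, herm y k = 0 := by
  intro k hk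
  have hk' : -k ∉ box N := fun h => hk (neg_mem_box.1 h)
  simp [herm, extend, hk, hk']

/-- For a Hermitian sequence the real part is even in k and the imaginary part odd, so both are
recovered from their sum. -/
lemma herm_coords {N : ℕ} {a : ℤ → ℂ} (ha : Hermitian a) : herm (coords N a) = trunc N a := by
  ext k
  by_cases hk : k ∈ box N
  · have hk' : -k ∈ box N := neg_mem_box.2 hk
    rw [trunc_of_mem hk]
    simp only [herm, extend, hk, hk', dif_pos, coords, ha k, Complex.conj_re, Complex.conj_im]
    apply Complex.ext
    · simp; ring
    · simp
  · rw [trunc_of_notMem hk, herm_support _ k hk]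

lemma coords_herm {N : ℕ} (y : box N → ℝ) : coords N (herm y) = y := by
  ext k
  have hk : (k : ℤ) ∈ box N := k.2
  simp only [coords, herm, Complex.add_re, Complex.add_im, Complex.ofReal_re, Complex.ofReal_im,
    Complex.mul_re, Complex.mul_im, Complex.I_re, Complex.I_im]
  simp only [extend, hk, dif_pos]
  ring

lemma extend_add {N : ℕ} (y z : box N → ℝ) (k : ℤ) : extend (y + z) k = extend y k + extend z k := by
  by_cases hk : k ∈ box N <;> simp [extend, hk]

lemma extend_smul {N : ℕ} (s : ℝ) (y : box N → ℝ) (k : ℤ) : extend (s • y) k = s * extend y k := by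
  by_cases hk : k ∈ box N <;> simp [extend, hk]

lemma herm_add {N : ℕ} (y z : box N → ℝ) : herm (y + z) = herm y + herm z := by
  ext k
  simp only [herm, extend_add, Pi.add_apply]
  push_cast; ring

lemma herm_smul {N : ℕ} (s : ℝ) (y : box N → ℝ) : herm (s • y) = (s : ℂ) • herm y := by
  ext k
  simp only [herm, extend_smul, Pi.smul_apply, smul_eq_mul]
  push_cast; ring

lemma herm_sub {N : ℕ} (y z : box N → ℝ) : herm (y - z) = herm y - herm z := by
  have := herm_add (y - z) z
  rw [sub_add_cancel] at this
  rw [this, add_sub_cancel_right]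

lemma contDiff_herm {N : ℕ} (k : ℤ) : ContDiff ℝ 1 fun y : box N → ℝ => herm y k := by
  have he : ∀ k : ℤ, ContDiff ℝ 1 fun y : box N → ℝ => extend y k := fun k => by
    by_cases hk : k ∈ box N
    · simp only [extend, hk, dif_pos]
      exact contDiff_apply ℝ ℝ (⟨k, hk⟩ : box N)
    · simp only [extend, hk, dif_neg, not_false_eq_true]
      exact contDiff_const
  have h1 := he k
  have h2 := he (-k)
  exact (Complex.ofRealCLM.contDiff.comp ((h1.add h2).div_const 2)).add
    ((Complex.ofRealCLM.contDiff.comp ((h1.sub h2).div_const 2)).mul contDiff_const)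

/-- The vector field of the Galerkin system in real coordinates. -/
def field (κ₁ κ₂ l d : ℝ) (N : ℕ) (y : (box N → ℝ) × (box N → ℝ)) : (box N → ℝ) × (box N → ℝ) :=
  (coords N (rhsZ κ₁ l (herm y.1) (herm y.2)), coords N (rhsU κ₂ l d (herm y.1) (herm y.2)))

lemma contDiff_coords {E : Type*} [NormedAddCommGroup E] [NormedSpace ℝ E] {N : ℕ} {F : E → ℤ → ℂ}
    (hF : ∀ k, ContDiff ℝ 1 fun y => F y k) : ContDiff ℝ 1 fun y => coords N (F y) :=
  contDiff_pi.2 fun k => (Complex.reCLM.contDiff.comp (hF k)).add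
    (Complex.imCLM.contDiff.comp (hF k))

lemma contDiff_field (κ₁ κ₂ l d : ℝ) (N : ℕ) : ContDiff ℝ 1 (field κ₁ κ₂ l d N) := by
  have h1 : ∀ k, ContDiff ℝ 1 fun y : (box N → ℝ) × (box N → ℝ) => herm y.1 k :=
    fun k => (contDiff_herm k).comp contDiff_fst
  have h2 : ∀ k, ContDiff ℝ 1 fun y : (box N → ℝ) × (box N → ℝ) => herm y.2 k :=
    fun k => (contDiff_herm k).comp contDiff_snd
  refine (contDiff_coords fun k => ?_).prodMk (contDiff_coords fun k => ?_)
  · simp only [rhsZ, conv_eq_sum (herm_support _)]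
    exact contDiff_const.mul ((contDiff_const.mul (h2 k)).add
      (contDiff_const.mul (ContDiff.sum fun m _ => (h1 _).mul (h2 m))))
  · simp only [rhsU, conv_eq_sum (herm_support _)]
    exact (contDiff_const.mul ((contDiff_const.mul (h1 k)).add
      (contDiff_const.mul (ContDiff.sum fun m _ => (h2 _).mul (h2 m))))).div_const _

/-! ### The cut-off of the error -/

/-- The smooth cut-off of the set where `N` times the energy is at most `1`. -/
def cutoff (d : ℝ) (N : ℕ) (y : (box N → ℝ) × (box N → ℝ)) : ℝ :=
  Real.smoothTransition (2 - N * energy d N (herm y.1) (herm y.2))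

lemma cutoff_sq_mul_le (d : ℝ) (N : ℕ) (y : (box N → ℝ) × (box N → ℝ)) :
    cutoff d N y ^ 2 * (N * energy d N (herm y.1) (herm y.2)) ≤ 2 := by
  rcases le_or_gt 2 (N * energy d N (herm y.1) (herm y.2)) with h | h
  · rw [cutoff, Real.smoothTransition.zero_of_nonpos (by linarith)]; norm_num
  · have h0 : 0 ≤ cutoff d N y := Real.smoothTransition.nonneg _
    have h1 : cutoff d N y ≤ 1 := Real.smoothTransition.le_one _
    have h2 : cutoff d N y ^ 2 ≤ 1 := by nlinarith
    nlinarith [sq_nonneg (cutoff d N y)]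

lemma contDiff_cutoff (d : ℝ) (N : ℕ) : ContDiff ℝ 1 (cutoff d N) := by
  refine (Real.smoothTransition.contDiff (n := 1)).comp (contDiff_const.sub (contDiff_const.mul ?_))
  exact ContDiff.sum fun k _ => ((contDiff_herm k).comp contDiff_fst).norm_sq ℝ |>.add
    (contDiff_const.mul (((contDiff_herm k).comp contDiff_snd).norm_sq ℝ))

/-- Coercivity of the energy: it confines the set where the cut-off is nonzero to a ball. The 2
arises because a coordinate is the sum of a real and an imaginary part. -/
lemma norm_le_two_mul_sqrt_energy {d : ℝ} (hd : 0 < d) {N : ℕ} (y : (box N → ℝ) × (box N → ℝ)) :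
    ‖y‖ ≤ 2 * √(energy d N (herm y.1) (herm y.2)) := by
  have key : ∀ z : box N → ℝ, ∑ k ∈ box N, ‖herm z k‖ ^ 2 ≤ energy d N (herm y.1) (herm y.2) →
      ‖z‖ ≤ 2 * √(energy d N (herm y.1) (herm y.2)) := by
    intro z hz
    refine (pi_norm_le_iff_of_nonneg (by positivity)).2 fun k => ?_
    have h1 : z k = (herm z k).re + (herm z k).im := (congrFun (coords_herm z) k).symm
    have h2 : ‖herm z k‖ ≤ √(energy d N (herm y.1) (herm y.2)) :=
      Real.le_sqrt_of_sq_le ((Finset.single_le_sum (f := fun k => ‖herm z k‖ ^ 2)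
        (fun _ _ => sq_nonneg _) k.2).trans hz)
    rw [h1, Real.norm_eq_abs]
    have h3 := Complex.abs_re_le_norm (herm z k)
    have h4 := Complex.abs_im_le_norm (herm z k)
    exact (abs_add_le _ _).trans (by linarith)
  exact max_le (key _ (sum_sq_fst_le_energy hd N _ _)) (key _ (sum_sq_snd_le_energy hd N _ _))

lemma hasCompactSupport_cutoff_smul {d : ℝ} (hd : 0 < d) {N : ℕ} (hN : 1 ≤ N) :
    HasCompactSupport fun y : (box N → ℝ) × (box N → ℝ) => cutoff d N y • y := by
  refine HasCompactSupport.of_support_subset_isCompact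
    (isCompact_closedBall (0 : (box N → ℝ) × (box N → ℝ)) (2 * √2)) fun y hy => ?_
  have hN' : (1 : ℝ) ≤ N := by exact_mod_cast hN
  have h1 : cutoff d N y ≠ 0 := fun h => hy (by simp [h])
  have h2 : N * energy d N (herm y.1) (herm y.2) < 2 := by
    by_contra! h
    exact h1 (Real.smoothTransition.zero_of_nonpos (by linarith))
  rw [mem_closedBall_zero_iff]
  refine (norm_le_two_mul_sqrt_energy hd y).trans (mul_le_mul_of_nonneg_left (Real.sqrt_le_sqrt ?_) two_pos.le)
  nlinarith [energy_nonneg hd N (herm y.1) (herm y.2)]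

/-! ### Existence, uniqueness and convergence for the coefficients -/

/-- A bounded `C¹` curve of `H^μ` sequences that solves the full system. -/
structure IsCoeffSolution (κ₁ κ₂ l d μ T M : ℝ) (a b : ℝ → ℤ → ℂ) : Prop where
  hermitian : ∀ t ∈ Icc (0 : ℝ) T, Hermitian (a t) ∧ Hermitian (b t)
  sobSummable : ∀ t ∈ Icc (0 : ℝ) T, SobSummable μ (a t) ∧ SobSummable μ (b t)
  sobSq_le : ∀ t ∈ Icc (0 : ℝ) T, sobSq μ (a t) ≤ M ∧ sobSq μ (b t) ≤ M
  deriv : ∀ t ∈ Icc (0 : ℝ) T, ∀ k : ℤ,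
    HasDerivWithinAt (fun s => a s k) (rhsZ κ₁ l (a t) (b t) k) (Icc 0 T) t ∧
    HasDerivWithinAt (fun s => b s k) (rhsU κ₂ l d (a t) (b t) k) (Icc 0 T) t

section

variable {κ₁ κ₂ l d μ T M : ℝ}

lemma hasDerivWithinAt_coords {N : ℕ} {a : ℝ → ℤ → ℂ} {a' : ℤ → ℂ} {s : Set ℝ} {t : ℝ}
    (h : ∀ k ∈ box N, HasDerivWithinAt (fun s => a s k) (a' k) s t) :
    HasDerivWithinAt (fun s => coords N (a s)) (coords N a') s t :=
  hasDerivWithinAt_pi.2 fun k =>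
    (Complex.reCLM.hasFDerivAt.comp_hasDerivWithinAt t (h k k.2)).add
      (Complex.imCLM.hasFDerivAt.comp_hasDerivWithinAt t (h k k.2))

lemma hasDerivWithinAt_herm {N : ℕ} {y : ℝ → box N → ℝ} {y' : box N → ℝ} {s : Set ℝ} {t : ℝ}
    (h : HasDerivWithinAt y y' s t) (k : ℤ) :
    HasDerivWithinAt (fun s => herm (y s) k) (herm y' k) s t := by
  have he : ∀ k : ℤ, HasDerivWithinAt (fun s => extend (y s) k) (extend y' k) s t := fun k => by
    by_cases hk : k ∈ box N
    · simp only [extend, hk, dif_pos]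
      exact hasDerivWithinAt_pi.1 h ⟨k, hk⟩
    · simp only [extend, hk, dif_neg, not_false_eq_true]
      exact hasDerivWithinAt_const _ _ _
  exact (((he k).fun_add (he (-k))).div_const 2).ofReal_comp.fun_add
    ((((he k).fun_sub (he (-k))).div_const 2).ofReal_comp.mul_const Complex.I)

/-- Uniqueness of the Galerkin approximation. -/
lemma IsCoeffGalerkin.unique {N : ℕ} {a₀ b₀ : ℤ → ℂ} {a b a' b' : ℝ → ℤ → ℂ}
    (h : IsCoeffGalerkin κ₁ κ₂ l d T N a₀ b₀ a b)
    (h' : IsCoeffGalerkin κ₁ κ₂ l d T N a₀ b₀ a' b') :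
    ∀ t ∈ Icc (0 : ℝ) T, a t = a' t ∧ b t = b' t := by
  have key : ∀ {a b : ℝ → ℤ → ℂ}, IsCoeffGalerkin κ₁ κ₂ l d T N a₀ b₀ a b →
      (∀ t ∈ Icc 0 T, herm (coords N (a t)) = a t ∧ herm (coords N (b t)) = b t) ∧
      ∀ t ∈ Icc 0 T, HasDerivWithinAt (fun s => (coords N (a s), coords N (b s)))
        (field κ₁ κ₂ l d N (coords N (a t), coords N (b t))) (Icc 0 T) t := by
    intro a b h
    have e : ∀ t ∈ Icc 0 T, herm (coords N (a t)) = a t ∧ herm (coords N (b t)) = b t :=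
      fun t ht => ⟨by rw [herm_coords (h.hermitian t ht).1, trunc_eq_self (h.support t ht).1],
        by rw [herm_coords (h.hermitian t ht).2, trunc_eq_self (h.support t ht).2]⟩
    refine ⟨e, fun t ht => ?_⟩
    rw [field, (e t ht).1, (e t ht).2]
    exact (hasDerivWithinAt_coords fun k hk => (h.deriv t ht k hk).1).prodMk
      (hasDerivWithinAt_coords fun k hk => (h.deriv t ht k hk).2)
  intro t ht
  have := eqOn_of_hasDerivWithinAt (contDiff_field κ₁ κ₂ l d N) (key h).2 (key h').2
    (by rw [h.init.1, h.init.2, h'.init.1, h'.init.2]) ht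
  have h1 := congrArg Prod.fst this
  have h2 := congrArg Prod.snd this
  rw [← ((key h).1 t ht).1, ← ((key h).1 t ht).2, ← ((key h').1 t ht).1, ← ((key h').1 t ht).2]
  exact ⟨congrArg herm h1, congrArg herm h2⟩

lemma hasDerivWithinAt_energy {N : ℕ} {θ ξ : ℝ → ℤ → ℂ} {a' b' a b : ℤ → ℂ} {s : Set ℝ} {t : ℝ}
    (h : ∀ k ∈ box N,
      HasDerivWithinAt (fun s => θ s k) (rhsZ κ₁ l a' b' k - rhsZ κ₁ l a b k) s t ∧
      HasDerivWithinAt (fun s => ξ s k) (rhsU κ₂ l d a' b' k - rhsU κ₂ l d a b k) s t) :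
    HasDerivWithinAt (fun s => energy d N (θ s) (ξ s))
      (2 * energyRate κ₁ κ₂ l d N (θ t) (ξ t) a' b' a b) s t := by
  rw [energyRate, Finset.mul_sum]
  refine HasDerivWithinAt.fun_sum fun k hk => ?_
  refine ((h k hk).1.norm_sq.fun_add ((h k hk).2.norm_sq.const_mul (symb d k))).congr_deriv ?_
  simp only [Complex.inner, mul_comm _ ((starRingEnd ℂ) _)]
  ring

lemma IsCoeffSolution.tail_le (hμ : 3 / 2 < μ) {a b : ℝ → ℤ → ℂ}
    (h : IsCoeffSolution κ₁ κ₂ l d μ T M a b) {N : ℕ} (hN : 1 ≤ N) {t : ℝ} (ht : t ∈ Icc 0 T) :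
    hsq (a t - trunc N (a t)) ≤ 2 * M * ((N : ℝ) ^ (1 - μ)) ^ 2 ∧
      hsq (b t - trunc N (b t)) ≤ 2 * M * ((N : ℝ) ^ (1 - μ)) ^ 2 := by
  have h1 := hsq_tail_le (by linarith) (h.sobSummable t ht).1 hN
  have h2 := hsq_tail_le (by linarith) (h.sobSummable t ht).2 hN
  have h3 := h.sobSq_le t ht
  constructor
  · exact h1.trans (by gcongr; exact h3.1)
  · exact h2.trans (by gcongr; exact h3.2)

/-- Existence of the Galerkin approximation for large `N`, with an error bound. -/
lemma IsCoeffSolution.exists_galerkin (hd : 0 < d) (hμ : 3 / 2 < μ) (hT : 0 < T) (hM : 0 ≤ M)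
    {a b : ℝ → ℤ → ℂ} (h : IsCoeffSolution κ₁ κ₂ l d μ T M a b) :
    ∃ (N₀ : ℕ) (C : ℝ), 0 ≤ C ∧ ∀ N : ℕ, N₀ ≤ N → ∃ a' b' : ℝ → ℤ → ℂ,
      IsCoeffGalerkin κ₁ κ₂ l d T N (a 0) (b 0) a' b' ∧ ∀ t ∈ Icc 0 T,
        energy d N (a' t - trunc N (a t)) (b' t - trunc N (b t)) ≤ C * ((N : ℝ) ^ (1 - μ)) ^ 2 := by
  -- The bound on `wnorm` of the exact solution, uniform in time, that the embedding provides.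
  set M₁ : ℝ := (∑' k : ℤ, (1 + |(k : ℝ)|) ^ 2 * (1 + (k : ℝ) ^ 2) ^ (-μ)) + M with hM₁
  have hM₁0 : 0 ≤ M₁ := add_nonneg (tsum_nonneg fun _ => by positivity) hM
  obtain ⟨K, hK0, hK⟩ := energyRate_le (κ₁ := κ₁) (κ₂ := κ₂) (l := l) hd hM₁0
  -- K + 1 replaces K because Grönwall is stated for a positive constant; 2M is the factor in τ².
  set C : ℝ := Real.exp (3 * (K + 1) * T) * (2 * M) with hC
  have hC0 : 0 ≤ C := by positivity
  -- This is the expected size of N·E; N₀ is chosen so that it is at most 1, the range where the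
  -- cut-off equals 1.
  have hlim : Tendsto (fun N : ℕ => C * (N : ℝ) ^ (-(2 * μ - 3))) atTop (𝓝 (C * 0)) :=
    ((tendsto_rpow_neg_atTop (by linarith)).comp tendsto_natCast_atTop_atTop).const_mul C
  rw [mul_zero] at hlim
  obtain ⟨N₀, hN₀⟩ := eventually_atTop.1
    ((hlim.eventually_le_const one_pos).and (eventually_ge_atTop 1))
  refine ⟨N₀, C, hC0, fun N hN => ?_⟩
  obtain ⟨hsmall, hN1⟩ := hN₀ N hN
  have hNpos : (0 : ℝ) < N := by exact_mod_cast hN1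
  set X := (box N → ℝ) × (box N → ℝ)
  set p : ℝ → X := fun t => (coords N (a t), coords N (b t)) with hp
  have hpc : ContinuousOn p (Icc 0 T) := fun t ht =>
    ((hasDerivWithinAt_coords fun k _ => (h.deriv t ht k).1).prodMk
      (hasDerivWithinAt_coords fun k _ => (h.deriv t ht k).2)).continuousWithinAt
  -- The cut-off is centred at the moving point p, the truncated exact solution, so it damps the
  -- error and not the approximation.
  obtain ⟨y, hy0, hy⟩ := exists_solution_of_cutoff (contDiff_field κ₁ κ₂ l d N)
    ((contDiff_cutoff d N).smul contDiff_id) (hasCompactSupport_cutoff_smul hd hN1) hT hpc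
  have hpa : ∀ t ∈ Icc 0 T, herm (p t).1 = trunc N (a t) :=
    fun t ht => herm_coords (h.hermitian t ht).1
  have hpb : ∀ t ∈ Icc 0 T, herm (p t).2 = trunc N (b t) :=
    fun t ht => herm_coords (h.hermitian t ht).2
  set s : ℝ → ℝ := fun t => cutoff d N (y t - p t) with hs
  set θ : ℝ → ℤ → ℂ := fun t => herm (y t - p t).1 with hθ
  set ξ : ℝ → ℤ → ℂ := fun t => herm (y t - p t).2 with hξ
  have hsupp : ∀ t k, k ∉ box N → θ t k = 0 ∧ ξ t k = 0 :=
    fun t k hk => ⟨herm_support _ k hk, herm_support _ k hk⟩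
  have hθ' : ∀ t ∈ Icc 0 T, θ t = herm (y t).1 - trunc N (a t) := fun t ht => by
    rw [hθ, ← hpa t ht, ← herm_sub]; rfl
  have hξ' : ∀ t ∈ Icc 0 T, ξ t = herm (y t).2 - trunc N (b t) := fun t ht => by
    rw [hξ, ← hpb t ht, ← herm_sub]; rfl
  have hfield : ∀ t ∈ Icc 0 T, field κ₁ κ₂ l d N (p t + s t • (y t - p t)) =
      (coords N (rhsZ κ₁ l (trunc N (a t) + (s t : ℂ) • θ t) (trunc N (b t) + (s t : ℂ) • ξ t)),
        coords N (rhsU κ₂ l d (trunc N (a t) + (s t : ℂ) • θ t)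
          (trunc N (b t) + (s t : ℂ) • ξ t))) := fun t ht => by
    rw [field, Prod.fst_add, Prod.snd_add, Prod.smul_fst, Prod.smul_snd, herm_add, herm_add,
      herm_smul, herm_smul, hpa t ht, hpb t ht]
  have hVH : ∀ t ∈ Icc 0 T, Hermitian (trunc N (a t) + (s t : ℂ) • θ t) ∧
      Hermitian (trunc N (b t) + (s t : ℂ) • ξ t) := fun t ht =>
    ⟨((h.hermitian t ht).1.trunc N).add ((herm_hermitian _).real_smul _),
      ((h.hermitian t ht).2.trunc N).add ((herm_hermitian _).real_smul _)⟩
  have hder : ∀ t ∈ Icc 0 T, ∀ k ∈ box N,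
      HasDerivWithinAt (fun r => herm (y r).1 k)
        (rhsZ κ₁ l (trunc N (a t) + (s t : ℂ) • θ t) (trunc N (b t) + (s t : ℂ) • ξ t) k)
        (Icc 0 T) t ∧
      HasDerivWithinAt (fun r => herm (y r).2 k)
        (rhsU κ₂ l d (trunc N (a t) + (s t : ℂ) • θ t) (trunc N (b t) + (s t : ℂ) • ξ t) k)
        (Icc 0 T) t := by
    intro t ht k hk
    have h1 : HasDerivWithinAt y (field κ₁ κ₂ l d N (p t + s t • (y t - p t))) (Icc 0 T) t := hy t ht
    rw [hfield t ht] at h1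
    have h2 := hasDerivWithinAt_herm (hasFDerivAt_fst.comp_hasDerivWithinAt t h1) k
    have h3 := hasDerivWithinAt_herm (hasFDerivAt_snd.comp_hasDerivWithinAt t h1) k
    simp only [ContinuousLinearMap.coe_fst', ContinuousLinearMap.coe_snd'] at h2 h3
    rw [herm_coords (rhsZ_hermitian _ _ (hVH t ht).1 (hVH t ht).2), trunc_of_mem hk] at h2
    rw [herm_coords (rhsU_hermitian _ _ _ (hVH t ht).1 (hVH t ht).2), trunc_of_mem hk] at h3
    exact ⟨h2, h3⟩
  have hE : ∀ t ∈ Icc 0 T, HasDerivWithinAt (fun r => energy d N (θ r) (ξ r))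
      (2 * energyRate κ₁ κ₂ l d N (θ t) (ξ t) (trunc N (a t) + (s t : ℂ) • θ t)
        (trunc N (b t) + (s t : ℂ) • ξ t) (a t) (b t)) (Icc 0 T) t := by
    intro t ht
    refine hasDerivWithinAt_energy fun k hk => ⟨?_, ?_⟩
    · refine ((hder t ht k hk).1.fun_sub (h.deriv t ht k).1).congr (fun r hr => ?_) ?_
      · rw [hθ' r hr, Pi.sub_apply, trunc_of_mem hk]
      · rw [hθ' t ht, Pi.sub_apply, trunc_of_mem hk]
    · refine ((hder t ht k hk).2.fun_sub (h.deriv t ht k).2).congr (fun r hr => ?_) ?_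
      · rw [hξ' r hr, Pi.sub_apply, trunc_of_mem hk]
      · rw [hξ' t ht, Pi.sub_apply, trunc_of_mem hk]
  set τ : ℝ := √(2 * M) * (N : ℝ) ^ (1 - μ) with hτ
  have hτ0 : 0 ≤ τ := by positivity
  have hτ2 : τ ^ 2 = 2 * M * ((N : ℝ) ^ (1 - μ)) ^ 2 := by
    rw [hτ, mul_pow, Real.sq_sqrt (by positivity)]
  have hbound : ∀ t ∈ Icc 0 T, energy d N (θ t) (ξ t) ≤ C * ((N : ℝ) ^ (1 - μ)) ^ 2 := by
    have hE0 : energy d N (θ 0) (ξ 0) = 0 := by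
      have hz : ∀ k : ℤ, herm (0 : box N → ℝ) k = 0 := fun k => by
        have := congrFun (herm_smul 0 (0 : box N → ℝ)) k
        simpa using this
      simp [hθ, hξ, hy0, energy, hz]
    intro t ht
    have := le_exp_mul_sq_of_deriv_le (K := K + 1) (τ := τ) (by positivity) hE hE0
      (fun r _ => energy_nonneg hd N _ _) (fun r hr => ?_) t ht
    · rw [hτ2] at this
      exact this.trans (le_of_eq (by rw [hC]; ring))
    · have hw := h.sobSummable r hr
      have hMr := h.sobSq_le r hr
      have hA := hw.1.wSummable hμ
      have hB := hw.2.wSummable hμ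
      have htail := h.tail_le hμ hN1 hr
      rw [← hτ2] at htail
      have hle := hK N (a r) (b r) (θ r) (ξ r) (s r) τ hN1 hA.1 hB.1 (h.hermitian r hr).2
        (herm_hermitian _) (hA.2.trans (by linarith [hMr.1])) (hB.2.trans (by linarith [hMr.2]))
        (fun k hk => (hsupp r k hk).1) (fun k hk => (hsupp r k hk).2)
        (Real.smoothTransition.nonneg _) (Real.smoothTransition.le_one _) hτ0
        (cutoff_sq_mul_le d N (y r - p r))
        (Real.sqrt_le_iff.2 ⟨hτ0, htail.1⟩) (Real.sqrt_le_iff.2 ⟨hτ0, htail.2⟩)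
      have hnn : 0 ≤ energy d N (θ r) (ξ r) + τ * √(energy d N (θ r) (ξ r)) :=
        add_nonneg (energy_nonneg hd N _ _) (by positivity)
      linarith
  -- The energy bound was proved for the damped system without assuming s = 1, so the argument is
  -- not circular.
  have hs1 : ∀ t ∈ Icc 0 T, s t = 1 := by
    intro t ht
    refine Real.smoothTransition.one_of_one_le ?_
    have h1 : N * energy d N (θ t) (ξ t) ≤ N * (C * ((N : ℝ) ^ (1 - μ)) ^ 2) :=
      mul_le_mul_of_nonneg_left (hbound t ht) hNpos.le
    have h2 : N * (C * ((N : ℝ) ^ (1 - μ)) ^ 2) = C * (N : ℝ) ^ (-(2 * μ - 3)) := by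
      have : (N : ℝ) ^ (-(2 * μ - 3)) = N * ((N : ℝ) ^ (1 - μ)) ^ 2 := by
        rw [← Real.rpow_mul_natCast hNpos.le]
        nth_rw 2 [← Real.rpow_one (N : ℝ)]
        rw [← Real.rpow_add hNpos]
        congr 1; push_cast; ring
      rw [this]; ring
    have h3 : N * energy d N (herm (y t - p t).1) (herm (y t - p t).2) ≤ 1 := by
      linarith
    linarith
  refine ⟨fun t => herm (y t).1, fun t => herm (y t).2, ⟨fun t _ => ⟨herm_hermitian _,
    herm_hermitian _⟩, fun t _ => ⟨herm_support _, herm_support _⟩, fun t ht k hk => ?_, ?_⟩,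
    fun t ht => ?_⟩
  · have h1 := hder t ht k hk
    rw [hs1 t ht, Complex.ofReal_one, one_smul, one_smul, hθ' t ht, hξ' t ht, add_sub_cancel,
      add_sub_cancel] at h1
    exact h1
  · have h0 : (0 : ℝ) ∈ Icc (0 : ℝ) T := ⟨le_rfl, hT.le⟩
    simp only [hy0]
    exact ⟨hpa 0 h0, hpb 0 h0⟩
  · have := hbound t ht
    rwa [hθ' t ht, hξ' t ht] at this

/-- For fixed `N` the error is bounded, since it is continuous in time. -/
lemma IsCoeffSolution.exists_energy_le {a b : ℝ → ℤ → ℂ}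
    (h : IsCoeffSolution κ₁ κ₂ l d μ T M a b) (N : ℕ) (a₀ b₀ : ℤ → ℂ) :
    ∃ C : ℝ, 0 ≤ C ∧ ∀ a' b' : ℝ → ℤ → ℂ, IsCoeffGalerkin κ₁ κ₂ l d T N a₀ b₀ a' b' →
      ∀ t ∈ Icc 0 T, energy d N (a' t - trunc N (a t)) (b' t - trunc N (b t)) ≤ C := by
  -- The constant must precede the solution; by uniqueness, one solution, if any exists, determines
  -- it.
  by_cases hex : ∃ a' b' : ℝ → ℤ → ℂ, IsCoeffGalerkin κ₁ κ₂ l d T N a₀ b₀ a' b'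
  · obtain ⟨a', b', h'⟩ := hex
    have hc : ContinuousOn
        (fun t => energy d N (a' t - trunc N (a t)) (b' t - trunc N (b t))) (Icc 0 T) :=
      fun t ht => (hasDerivWithinAt_energy (κ₁ := κ₁) (κ₂ := κ₂) (l := l) (a' := a' t)
        (b' := b' t) (a := a t) (b := b t) fun k hk => by
          simp only [Pi.sub_apply, trunc_of_mem hk]
          exact ⟨(h'.deriv t ht k hk).1.fun_sub (h.deriv t ht k).1,
            (h'.deriv t ht k hk).2.fun_sub (h.deriv t ht k).2⟩).continuousWithinAt
    obtain ⟨C, hC⟩ := isCompact_Icc.exists_bound_of_continuousOn hc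
    refine ⟨max C 0, le_max_right _ _, fun a'' b'' h'' t ht => ?_⟩
    obtain ⟨e1, e2⟩ := h''.unique h' t ht
    rw [e1, e2]
    exact ((le_abs_self _).trans (hC t ht)).trans (le_max_left _ _)
  · exact ⟨0, le_rfl, fun a' b' h' => (hex ⟨a', b', h'⟩).elim⟩

/-- The optimal-order bound on the projection error, for every `N`. -/
lemma IsCoeffSolution.exists_energy_le_rpow (hd : 0 < d) (hμ : 3 / 2 < μ) (hT : 0 < T)
    (hM : 0 ≤ M) {a b : ℝ → ℤ → ℂ} (h : IsCoeffSolution κ₁ κ₂ l d μ T M a b) :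
    ∃ C : ℝ, 0 ≤ C ∧ ∀ N : ℕ, 1 ≤ N → ∀ a' b' : ℝ → ℤ → ℂ,
      IsCoeffGalerkin κ₁ κ₂ l d T N (a 0) (b 0) a' b' → ∀ t ∈ Icc 0 T,
        energy d N (a' t - trunc N (a t)) (b' t - trunc N (b t)) ≤ C * ((N : ℝ) ^ (1 - μ)) ^ 2 := by
  obtain ⟨N₀, C, hC0, hC⟩ := h.exists_galerkin hd hμ hT hM
  choose D hD0 hD using fun N => h.exists_energy_le N (a 0) (b 0)
  have hpos : ∀ N : ℕ, 1 ≤ N → 0 < ((N : ℝ) ^ (1 - μ)) ^ 2 := fun N hN => by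
    have : (0 : ℝ) < N := by exact_mod_cast hN
    positivity
  have hq : ∀ N : ℕ, 0 ≤ D N / ((N : ℝ) ^ (1 - μ)) ^ 2 := fun N =>
    div_nonneg (hD0 N) (sq_nonneg _)
  have hS : 0 ≤ ∑ N ∈ Finset.range N₀, D N / ((N : ℝ) ^ (1 - μ)) ^ 2 :=
    Finset.sum_nonneg fun N _ => hq N
  -- Each N below N₀ contributes its own bound divided by the rate; the sum dominates every one of
  -- these nonnegative terms.
  refine ⟨C + ∑ N ∈ Finset.range N₀, D N / ((N : ℝ) ^ (1 - μ)) ^ 2, by positivity,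
    fun N hN a' b' h' t ht => ?_⟩
  rcases le_or_gt N₀ N with hle | hlt
  · obtain ⟨a'', b'', h'', hb⟩ := hC N hle
    obtain ⟨e1, e2⟩ := h'.unique h'' t ht
    rw [e1, e2]
    refine (hb t ht).trans (mul_le_mul_of_nonneg_right ?_ (hpos N hN).le)
    linarith
  · refine (hD N a' b' h' t ht).trans ?_
    rw [← div_le_iff₀ (hpos N hN)]
    have := Finset.single_le_sum (f := fun N : ℕ => D N / ((N : ℝ) ^ (1 - μ)) ^ 2)
      (fun N _ => hq N) (Finset.mem_range.2 hlt)
    linarith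

end

/-! ### Norms of the error -/

/-- The error against the truncation lives on `box N` and the truncation error off it, so by
Parseval their squares add without a factor 2. The second argument of the energy is free, since only
the first is used. -/
lemma normL2_sub_sq_le {d : ℝ} (hd : 0 < d) {N : ℕ} {f g : ℝ → ℝ} (hf : MemTrig N f)
    (hg : MemLp g 2 (volume.restrict (Ioc (0 : ℝ) 1))) (hw : WSummable (coeff g)) (ξ : ℤ → ℂ) :
    normL2 (fun x => f x - g x) ^ 2
      ≤ energy d N (coeff f - trunc N (coeff g)) ξ + hsq (coeff g - trunc N (coeff g)) := by
  have hfL := memLp_of_continuous hf.contDiff_one.continuous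
  have hP := hasSum_sq_coeff (hfL.sub hg)
  have hc : coeff (f - g) = coeff f - coeff g :=
    coeff_sub (intervalIntegrable_of_memLp hfL) (intervalIntegrable_of_memLp hg)
  rw [hc] at hP
  have e : normL2 (fun x => f x - g x) ^ 2 = ∑' k, ‖(coeff f - coeff g) k‖ ^ 2 := by
    rw [hP.tsum_eq]
    exact Real.sq_sqrt (intervalIntegral.integral_nonneg zero_le_one fun _ _ => sq_nonneg _)
  have hbox : HasSum (fun k => ‖(coeff f - trunc N (coeff g)) k‖ ^ 2)
      (∑ k ∈ box N, ‖(coeff f - trunc N (coeff g)) k‖ ^ 2) :=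
    hasSum_sum_of_ne_finset_zero fun k hk => by
      simp [hf.coeff_eq_zero k hk, trunc_of_notMem hk]
  have htail := ((hw.sub (wSummable_trunc (coeff g) N)).sq).hasSum
  rw [e]
  refine (hP.summable.tsum_le_tsum (fun k => ?_) (hbox.add htail).summable).trans
    ((hbox.add htail).tsum_eq.le.trans (add_le_add_left (sum_sq_fst_le_energy hd N _ _) _))
  by_cases hk : k ∈ box N
  · simp [trunc_of_mem hk]
  · simp only [Pi.sub_apply, hf.coeff_eq_zero k hk, trunc_of_notMem hk, zero_sub, sub_zero,
      norm_neg, norm_zero]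
    have : 1 ≤ (1 + |(k : ℝ)|) ^ 2 := by nlinarith [abs_nonneg (k : ℝ)]
    rw [mul_pow]
    nlinarith [sq_nonneg ‖coeff g k‖]

lemma normH_one_sub_sq_le {d B : ℝ}
    (hB : ∀ k : ℤ, (1 + |(k : ℝ)|) ^ 2 ≤ B ^ 2 * symb d k) {N : ℕ} {f g : ℝ → ℝ}
    (hf : MemTrig N f) (hg : MemLp g 2 (volume.restrict (Ioc (0 : ℝ) 1)))
    (hw : WSummable (coeff g)) (θ : ℤ → ℂ) :
    normH 1 (fun x => f x - g x) ^ 2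
      ≤ B ^ 2 * energy d N θ (coeff f - trunc N (coeff g))
        + hsq (coeff g - trunc N (coeff g)) := by
  have hfL := memLp_of_continuous hf.contDiff_one.continuous
  have hc : coeff (fun x => f x - g x) = coeff f - coeff g :=
    coeff_sub (intervalIntegrable_of_memLp hfL) (intervalIntegrable_of_memLp hg)
  rw [normH_sq, hc]
  have hbox : HasSum (fun k => B ^ 2 * (symb d k * ‖(coeff f - trunc N (coeff g)) k‖ ^ 2))
      (∑ k ∈ box N, B ^ 2 * (symb d k * ‖(coeff f - trunc N (coeff g)) k‖ ^ 2)) :=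
    hasSum_sum_of_ne_finset_zero fun k hk => by
      simp [hf.coeff_eq_zero k hk, trunc_of_notMem hk]
  have htail := ((hw.sub (wSummable_trunc (coeff g) N)).sq).hasSum
  have hle : ∀ k : ℤ, (1 + (k : ℝ) ^ 2) ^ (1 : ℝ) * ‖(coeff f - coeff g) k‖ ^ 2 ≤
      B ^ 2 * (symb d k * ‖(coeff f - trunc N (coeff g)) k‖ ^ 2)
        + ((1 + |(k : ℝ)|) * ‖(coeff g - trunc N (coeff g)) k‖) ^ 2 := by
    intro k
    have h1 : 1 + (k : ℝ) ^ 2 ≤ (1 + |(k : ℝ)|) ^ 2 := by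
      nlinarith [abs_nonneg (k : ℝ), sq_abs (k : ℝ)]
    rw [Real.rpow_one]
    by_cases hk : k ∈ box N
    · simp only [Pi.sub_apply, trunc_of_mem hk, sub_self, norm_zero, mul_zero]
      have := mul_le_mul_of_nonneg_right (h1.trans (hB k)) (sq_nonneg ‖coeff f k - coeff g k‖)
      linarith
    · simp only [Pi.sub_apply, hf.coeff_eq_zero k hk, trunc_of_notMem hk, zero_sub, sub_zero,
        norm_neg, norm_zero]
      have := mul_le_mul_of_nonneg_right h1 (sq_nonneg ‖coeff g k‖)
      rw [mul_pow]
      linarith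
  have hs : Summable fun k : ℤ =>
      (1 + (k : ℝ) ^ 2) ^ (1 : ℝ) * ‖(coeff f - coeff g) k‖ ^ 2 :=
    Summable.of_nonneg_of_le (fun _ => by positivity) hle (hbox.add htail).summable
  refine (hs.tsum_le_tsum hle (hbox.add htail).summable).trans
    ((hbox.add htail).tsum_eq.le.trans (add_le_add_left ?_ _))
  rw [energy, Finset.mul_sum]
  refine Finset.sum_le_sum fun k _ => mul_le_mul_of_nonneg_left ?_ (sq_nonneg B)
  exact le_add_of_nonneg_left (sq_nonneg _)

lemma IsSolution.isCoeffSolution {γ δ d μ T : ℝ} (hd : 0 < d) (hμ : 0 ≤ μ) {ζ₀ u₀ : ℝ → ℝ}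
    {ζ u : ℝ → ℝ → ℝ} (h : IsSolution γ δ 0 0 0 d μ T ζ₀ u₀ ζ u) :
    ∃ M : ℝ, 0 ≤ M ∧ IsCoeffSolution (kappa1 γ δ) (kappa2 γ) (lam γ δ) d μ T M
      (fun t => coeff (ζ t)) (fun t => coeff (u t)) := by
  obtain ⟨hmem, ⟨M, hM0, hM⟩, hder, -, -⟩ := h.fourier hd hμ
  exact ⟨M, hM0, fun t _ => ⟨coeff_hermitian _, coeff_hermitian _⟩,
    fun t ht => ⟨(hmem t ht).1.summable, (hmem t ht).2.summable⟩, hM, hder⟩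

end

end Boussinesq

/-! ### Return from coefficients to functions -/

theorem mainTheorem4 (γ δ d μ T : ℝ) (hγ0 : 0 ≤ γ) (hγ1 : γ < 1) (hδ : 0 < δ) (hd : 0 < d)
    (hμ : 3 / 2 < μ) (hT : 0 < T) (ζ₀ u₀ : ℝ → ℝ) (ζ u : ℝ → ℝ → ℝ)
    (hsol : Boussinesq.IsSolution γ δ 0 0 0 d μ T ζ₀ u₀ ζ u) :
    (∃ N₀ : ℕ, ∀ N : ℕ, N₀ ≤ N →
      ∃ ζN uN : ℝ → ℝ → ℝ, Boussinesq.IsGalerkin γ δ 0 0 0 d T N ζ₀ u₀ ζN uN) ∧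
    (∀ N : ℕ, 1 ≤ N → ∀ ζN uN ζN' uN' : ℝ → ℝ → ℝ,
      Boussinesq.IsGalerkin γ δ 0 0 0 d T N ζ₀ u₀ ζN uN →
      Boussinesq.IsGalerkin γ δ 0 0 0 d T N ζ₀ u₀ ζN' uN' →
      ∀ t ∈ Set.Icc (0 : ℝ) T, ζN t = ζN' t ∧ uN t = uN' t) ∧
    (∃ C : ℝ, ∀ N : ℕ, 1 ≤ N → ∀ ζN uN : ℝ → ℝ → ℝ,
      Boussinesq.IsGalerkin γ δ 0 0 0 d T N ζ₀ u₀ ζN uN →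
      ∀ t ∈ Set.Icc (0 : ℝ) T,
        Boussinesq.normL2 (fun x => ζN t x - ζ t x)
            + Boussinesq.normH 1 (fun x => uN t x - u t x)
          ≤ C * (N : ℝ) ^ (1 - μ)) := by
  have hμ0 : 0 ≤ μ := by linarith
  obtain ⟨hmem, -, -, hζ0, hu0⟩ := hsol.fourier hd hμ0
  obtain ⟨M, hM0, hcs⟩ := hsol.isCoeffSolution hd hμ0
  refine ⟨?_, ?_, ?_⟩
  · obtain ⟨N₀, C, -, hN₀⟩ := hcs.exists_galerkin hd hμ hT hM0
    refine ⟨N₀, fun N hN => ?_⟩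
    obtain ⟨a, b, h, -⟩ := hN₀ N hN
    simp only [hζ0, hu0] at h
    exact ⟨_, _, h.isGalerkin hd hT⟩
  · intro N _ ζN uN ζN' uN' h h' t ht
    obtain ⟨e1, e2⟩ := (h.coeff hd hT).unique (h'.coeff hd hT) t ht
    -- Elements of S_N equal their trigonometric polynomial at every x, so equal coefficients give
    -- equality everywhere and not merely almost everywhere.
    constructor
    · ext x
      have := (h.1 t ht).1.eq_trigPoly x
      rw [e1, ← (h'.1 t ht).1.eq_trigPoly x] at this
      exact_mod_cast this
    · ext x
      have := (h.1 t ht).2.eq_trigPoly x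
      rw [e2, ← (h'.1 t ht).2.eq_trigPoly x] at this
      exact_mod_cast this
  · obtain ⟨C, hC0, hC⟩ := hcs.exists_energy_le_rpow hd hμ hT hM0
    obtain ⟨B, hB0, hB⟩ := Boussinesq.exists_weight_le_symb hd
    -- Under each root: C from the energy, scaled by B² when passing to the H¹ norm, and 2M from the
    -- truncation error.
    refine ⟨√(C + 2 * M) + √(B ^ 2 * C + 2 * M), fun N hN ζN uN h t ht => ?_⟩
    have hE := hC N hN _ _ (by simpa only [hζ0, hu0] using h.coeff hd hT) t ht
    have htail := hcs.tail_le hμ hN ht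
    have hNr : (0 : ℝ) ≤ (N : ℝ) ^ (1 - μ) := by positivity
    have h1 := Boussinesq.normL2_sub_sq_le hd (h.1 t ht).1 (hmem t ht).1.memLp
      (Boussinesq.SobSummable.wSummable hμ (hmem t ht).1.summable).1
      (Boussinesq.coeff (uN t) - Boussinesq.trunc N (Boussinesq.coeff (u t)))
    have h2 := Boussinesq.normH_one_sub_sq_le hB (h.1 t ht).2 (hmem t ht).2.memLp
      (Boussinesq.SobSummable.wSummable hμ (hmem t ht).2.summable).1
      (Boussinesq.coeff (ζN t) - Boussinesq.trunc N (Boussinesq.coeff (ζ t)))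
    rw [add_mul]
    refine add_le_add ?_ ?_
    · refine le_of_sq_le_sq ?_ (by positivity)
      rw [mul_pow, Real.sq_sqrt (by positivity)]
      linarith [htail.1]
    · refine le_of_sq_le_sq ?_ (by positivity)
      rw [mul_pow, Real.sq_sqrt (by positivity)]
      nlinarith [htail.2, mul_le_mul_of_nonneg_left hE (sq_nonneg B)]
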